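/- Let $(\Omega,\mathcal B,\mu)$ be a probability space. Put $\cosh_2(x)=\cosh x-1$, with conjugate Young function $\cosh_2^*(y)=\int_0^{|y|}\sinh^{-1}(v)\,dv = y\sinh^{-1}y-\sqrt{1+y^2}+1$. For a probability measure $\nu$ on $(\Omega,\mathcal B)$ and $\Phi\in\{\cosh_2,\cosh_2^*\}$ let $L^\Phi(\nu)$ be the Orlicz space of the ($\nu$-classes of) real random variables $f$ with $\int\Phi(\rho^{-1}f)\,d\nu<\infty$ for some $\rho>0$, with the Luxemburg norm $\|f\|=\inf\{\rho>0:\int\Phi(\rho^{-1}f)\,d\nu\le 1\}$. A positive density is a $\mu$-a.e. positive random variable $p$ with $\int p\,d\mu=1$; write $L^\Phi(p)=L^\Phi(p\cdot\mu)$, $L^\alpha(p)=L^\alpha(p\cdot\mu)$ and $K_p(u)=\log\int \mathrm e^{u}\,p\,d\mu\in(-\infty,\infty]$, whose proper domain is the set where it is finite. The maximal exponential model $\mathcal E(\mu)$ is the set of the densities $\mathrm e^{u-K_1(u)}$ with $u\in B=\{u\in L^{\cosh_2}(\mu):\int u\,d\mu=0\}$ in the interior (in $B$) of the proper domain of $K_1$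 (the functional $K_p$ for $p=1$). For all densities $p,q\in\mathcal E(\mu)$ the following are equivalent: 1. $q=\mathrm e^{u-K_p(u)}\cdot p$ for some $u\in L^{\cosh_2}(\mu)$ with $\int u\,p\,d\mu=0$ that belongs to the interior of the proper domain of $K_p$, as a subset of the space $\{u\in L^{\cosh_2}(\mu):\int u\,p\,d\mu=0\}$; 2. $p$ and $q$ are connected by an open exponential arc: there are an open interval $I\supset[0,1]$, a random variable $U$ and probability densities $r_\theta\propto \mathrm e^{\theta U}\cdot p$, $\theta\in I$, with $r_0=p$ and $r_1=q$; 3. $L^{\cosh_2}(p)=L^{\cosh_2}(q)$ and the norms are equivalent; 4. $p/q\in\bigcup_{\alpha>1}L^\alpha(q)$ and $q/p\in\bigcup_{\alpha>1}L^\alpha(p)$; 5. the mapping $v\mapsto \frac pq\,v$ is an isomorphism of the Banach space $L^{\cosh_2^*}(p)$ onto the Banach space $L^{\cosh_2^*}(q)$. Moreover, the same five conditions, with $L^{\cosh_2}(\mu)$ replaced by $L^{\cosh_2}(p)$ in condition 1, are equivalent for any two positive densities $p,q$ with respect to $\mu$, whether or not they belong to $\mathcal E(\mu)$. -/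

import Mathlib

open MeasureTheory Set
open scoped ENNReal

noncomputable section

namespace MaxExp

variable {Ω : Type*} [MeasurableSpace Ω]

/-! Orlicz spaces. Random variables are represented by real functions, and two of them are
identified when they are equal almost everywhere. -/

/-- The Young function `cosh x - 1`. -/
def cosh2 (x : ℝ) : ℝ := Real.cosh x - 1

/-- The Young function conjugate to `cosh2`, that is, `∫ v in 0..|y|, arsinh v`. -/
def cosh2Conj (y : ℝ) : ℝ := y * Real.arsinh y - √(1 + y ^ 2) + 1

/-- `f` belongs to the Orlicz space `L^Φ(ν)`: `f` is measurable up to a null set and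
`∫ Φ(f / ρ) dν` is finite for some `ρ > 0`. -/
def MemOrlicz (Φ : ℝ → ℝ) (ν : Measure Ω) (f : Ω → ℝ) : Prop :=
  AEMeasurable f ν ∧ ∃ ρ : ℝ, 0 < ρ ∧ ∫⁻ x, ENNReal.ofReal (Φ (ρ⁻¹ * f x)) ∂ν < ∞

/-- The Luxemburg norm of an element of `L^Φ(ν)`. -/
def luxNorm (Φ : ℝ → ℝ) (ν : Measure Ω) (f : Ω → ℝ) : ℝ :=
  sInf {ρ : ℝ | 0 < ρ ∧ ∫⁻ x, ENNReal.ofReal (Φ (ρ⁻¹ * f x)) ∂ν ≤ 1}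

/-- `L^Φ(ν₁) = L^Φ(ν₂)` with equivalent Luxemburg norms. -/
def SameOrlicz (Φ : ℝ → ℝ) (ν₁ ν₂ : Measure Ω) : Prop :=
  (∀ f : Ω → ℝ, MemOrlicz Φ ν₁ f ↔ MemOrlicz Φ ν₂ f) ∧
    ∃ c C : ℝ, 0 < c ∧ 0 < C ∧ ∀ f : Ω → ℝ, MemOrlicz Φ ν₁ f →
      c * luxNorm Φ ν₁ f ≤ luxNorm Φ ν₂ f ∧ luxNorm Φ ν₂ f ≤ C * luxNorm Φ ν₁ f

/-- The (linear) operator `v ↦ m v` of multiplication by `m` is an isomorphism of the Banach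
space `L^Φ(ν₁)` onto the Banach space `L^Φ(ν₂)`: it maps the first space into the second and
onto it, and it is bounded above and below (in particular one-to-one, with bounded inverse). -/
def MulIsoOrlicz (Φ : ℝ → ℝ) (ν₁ ν₂ : Measure Ω) (m : Ω → ℝ) : Prop :=
  (∀ v : Ω → ℝ, MemOrlicz Φ ν₁ v → MemOrlicz Φ ν₂ (fun x => m x * v x)) ∧
    (∀ w : Ω → ℝ, MemOrlicz Φ ν₂ w →
      ∃ v : Ω → ℝ, MemOrlicz Φ ν₁ v ∧ w =ᵐ[ν₂] fun x => m x * v x) ∧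
    ∃ c C : ℝ, 0 < c ∧ 0 < C ∧ ∀ v : Ω → ℝ, MemOrlicz Φ ν₁ v →
      c * luxNorm Φ ν₁ v ≤ luxNorm Φ ν₂ (fun x => m x * v x) ∧
        luxNorm Φ ν₂ (fun x => m x * v x) ≤ C * luxNorm Φ ν₁ v

/-! Densities, the moment and the cumulant functional. -/

/-- `p` is a positive probability density with respect to `μ`. -/
def IsPosDensity (μ : Measure Ω) (p : Ω → ℝ) : Prop :=
  AEMeasurable p μ ∧ (∀ᵐ x ∂μ, 0 < p x) ∧ ∫⁻ x, ENNReal.ofReal (p x) ∂μ = 1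

/-- The measure `p · μ` with density `p`. -/
def densMeasure (μ : Measure Ω) (p : Ω → ℝ) : Measure Ω :=
  μ.withDensity fun x => ENNReal.ofReal (p x)

/-- The moment functional `M_π(u) = ∫ e^u dπ`, with values in `[0, ∞]`. -/
def momentFn (π : Measure Ω) (u : Ω → ℝ) : ℝ≥0∞ :=
  ∫⁻ x, ENNReal.ofReal (Real.exp (u x)) ∂π

/-- The cumulant functional `K_π(u) = log M_π(u)`, used where `M_π(u)` is finite. -/
def cumulantFn (π : Measure Ω) (u : Ω → ℝ) : ℝ := Real.log (momentFn π u).toReal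

/-- The random variables in `L^{cosh2}(ν)` that are centred with respect to `π`. -/
def MemCentred (ν π : Measure Ω) (u : Ω → ℝ) : Prop :=
  MemOrlicz cosh2 ν u ∧ Integrable u π ∧ ∫ x, u x ∂π = 0

/-- `u` lies in the interior of the proper domain `{M_π < ∞}` of the cumulant functional, as a
subset of the space of the random variables in `L^{cosh2}(ν)` centred with respect to `π`,
with the Luxemburg norm of `L^{cosh2}(ν)`. -/
def MemInteriorDomain (ν π : Measure Ω) (u : Ω → ℝ) : Prop :=
  MemCentred ν π u ∧ ∃ ε : ℝ, 0 < ε ∧ ∀ v : Ω → ℝ, MemCentred ν π v →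
    luxNorm cosh2 ν (fun x => v x - u x) < ε → momentFn π v < ∞

/-- `p` belongs to the maximal exponential model of `μ`: `p = e^{u - K_μ(u)}` with `u` centred
and in the interior of the proper domain of `K_μ`. -/
def MemMaxExp (μ : Measure Ω) (p : Ω → ℝ) : Prop :=
  ∃ u : Ω → ℝ, MemInteriorDomain μ μ u ∧
    p =ᵐ[μ] fun x => Real.exp (u x - cumulantFn μ u)

/-! The conditions on two densities `p` and `q`. -/

/-- `q = e^{u - K_p(u)} · p` for some `u` in `L^{cosh2}(ν)`, centred with respect to `p · μ`,
in the interior of the proper domain of `K_p`. -/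
def IsExpDensity (ν μ : Measure Ω) (p q : Ω → ℝ) : Prop :=
  ∃ u : Ω → ℝ, MemInteriorDomain ν (densMeasure μ p) u ∧
    q =ᵐ[μ] fun x => Real.exp (u x - cumulantFn (densMeasure μ p) u) * p x

/-- `p` and `q` are connected by an open exponential arc: there are an open interval `I`
containing `[0, 1]`, a random variable `U` and a family of probability densities `r θ`, `θ ∈ I`,
proportional to `e^{θ U} · p`, with `r 0 = p` and `r 1 = q`. -/
def OpenExpArc (μ : Measure Ω) (p q : Ω → ℝ) : Prop :=
  ∃ (I : Set ℝ) (U : Ω → ℝ) (r : ℝ → Ω → ℝ),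
    IsOpen I ∧ I.OrdConnected ∧ Icc 0 1 ⊆ I ∧ AEMeasurable U μ ∧
    (∀ θ ∈ I, IsPosDensity μ (r θ) ∧
      ∃ c : ℝ, 0 < c ∧ r θ =ᵐ[μ] fun x => c * (Real.exp (θ * U x) * p x)) ∧
    r 0 =ᵐ[μ] p ∧ r 1 =ᵐ[μ] q

/-- `f` belongs to the union over `α > 1` of the Lebesgue spaces `L^α(ν)`. -/
def MemUnionLp (ν : Measure Ω) (f : Ω → ℝ) : Prop :=
  ∃ α : ℝ, 1 < α ∧ MemLp f (ENNReal.ofReal α) ν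

end MaxExp

end

/-!
Write `P = p · μ`, `Q = q · μ` and `f = log (q / p)`, so that `Q = e^f · P`. Each of the five
conditions is equivalent to the existence of some `ε > 0` with `∫ e^{-ε f} dP < ∞` and
`∫ e^{ε f} dQ = ∫ e^{(1 + ε) f} dP < ∞`: the moments of `f` under `P` are finite on an open interval
containing `[0, 1]`. This pair of conditions is invariant under exchanging `(P, f)` with `(Q, -f)`,
so every comparison is proved in one direction only.

* For exponential arcs and for the Lebesgue spaces this is a rewriting of the integrals
  (`openExpArc_iff`, `memUnionLp_and_iff`).
* For the exponential representation the relevant `u` is `f` up to a constant. Stretching an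
  interior `u` by a factor `1 + t` stays in the proper domain; conversely a finite moment beyond `1`
  absorbs perturbations of small norm, by the Young inequality (`isExpDensity_iff`).
* For the spaces `L^{cosh2}`, the Young inequality bounds the modular under `Q` by that under `P`
  plus a moment of `f` (`IsTilt.modularBounded_cosh2`). In the other direction the positive part
  of `f` always lies in `L^{cosh2}(P)`, and its membership in `L^{cosh2}(Q)` is an exponential
  moment (`IsTilt.hasExpMoment_of_memOrlicz_imp`).
* For the conjugate spaces, `∫ cosh2Conj(e^{-f} v) dQ` behaves like `∫ |v| log (e^{-f} |v|) dP`, so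
  that boundedness of the multiplication amounts to boundedness of `v ↦ ∫ v f⁻ dP` on
  `L^{cosh2Conj}(P)`, that is, to an exponential moment under `P` of the
  negative part `f⁻` of `f`
  (`IsTilt.modularBounded_cosh2Conj`, `IsTilt.hasExpMoment_of_luxNorm_le`).

If `p` belongs to the maximal exponential model, the equivalences for the pair `(1, p)` give
`L^{cosh2}(μ) = L^{cosh2}(p)` with equivalent norms, so the two versions of the exponential
representation have the same interior points and agree.
-/

namespace MaxExp

variable {Ω : Type*} [MeasurableSpace Ω]

/-! ### The two Young functions -/

lemma cosh2_nonneg (x : ℝ) : 0 ≤ cosh2 x := sub_nonneg.2 (Real.one_le_cosh x)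

lemma cosh2_le_of_abs_le {x y : ℝ} (h : |x| ≤ |y|) : cosh2 x ≤ cosh2 y :=
  sub_le_sub_right (Real.cosh_le_cosh.2 h) 1

lemma cosh2_le_exp_abs (x : ℝ) : cosh2 x ≤ Real.exp |x| := by
  have h1 : Real.exp (-|x|) ≤ 1 := Real.exp_le_one_iff.2 (by simp)
  have h2 := Real.exp_pos |x|
  rw [cosh2, ← Real.cosh_abs, Real.cosh_eq]
  linarith

lemma exp_le_two_mul_cosh2_add_two (x : ℝ) : Real.exp x ≤ 2 * cosh2 x + 2 := by
  have h := Real.exp_pos (-x)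
  rw [cosh2, Real.cosh_eq]
  linarith

lemma exp_abs_le_two_mul_cosh2_add_two (x : ℝ) : Real.exp |x| ≤ 2 * cosh2 x + 2 := by
  have h := exp_le_two_mul_cosh2_add_two |x|
  rwa [cosh2, Real.cosh_abs] at h

/-- The graph of `cosh` lies above its tangents. -/
lemma cosh_add_sinh_mul_sub_le (x t : ℝ) :
    Real.cosh t + Real.sinh t * (x - t) ≤ Real.cosh x := by
  have h1 : Real.exp t * (x - t + 1) ≤ Real.exp x :=
    calc Real.exp t * (x - t + 1) ≤ Real.exp t * Real.exp (x - t) :=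
          mul_le_mul_of_nonneg_left (Real.add_one_le_exp _) (Real.exp_pos _).le
      _ = Real.exp x := by rw [← Real.exp_add]; ring_nf
  have h2 : Real.exp (-t) * (t - x + 1) ≤ Real.exp (-x) :=
    calc Real.exp (-t) * (t - x + 1) ≤ Real.exp (-t) * Real.exp (t - x) :=
          mul_le_mul_of_nonneg_left (Real.add_one_le_exp _) (Real.exp_pos _).le
      _ = Real.exp (-x) := by rw [← Real.exp_add]; ring_nf
  rw [Real.cosh_eq, Real.cosh_eq, Real.sinh_eq]
  linarith

lemma cosh2Conj_sinh (t : ℝ) : cosh2Conj (Real.sinh t) = t * Real.sinh t - cosh2 t := by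
  rw [cosh2Conj, Real.arsinh_sinh, cosh2, ← Real.cosh_sq', Real.sqrt_sq (Real.cosh_pos t).le]
  ring

lemma cosh2Conj_eq (y : ℝ) : cosh2Conj y = Real.arsinh y * y - cosh2 (Real.arsinh y) := by
  conv_lhs => rw [← Real.sinh_arsinh y, cosh2Conj_sinh, Real.sinh_arsinh]

/-- The Young inequality. -/
lemma mul_le_cosh2Conj_add_cosh2 (x y : ℝ) : y * x ≤ cosh2Conj y + cosh2 x := by
  have h := cosh_add_sinh_mul_sub_le x (Real.arsinh y)
  rw [Real.sinh_arsinh] at h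
  rw [cosh2Conj_eq, cosh2, cosh2]
  linarith

lemma cosh2Conj_nonneg (y : ℝ) : 0 ≤ cosh2Conj y := by
  have h := mul_le_cosh2Conj_add_cosh2 0 y
  simpa [cosh2] using h

lemma arsinh_abs (y : ℝ) : Real.arsinh |y| = |Real.arsinh y| := by
  rcases le_total 0 y with h | h
  · rw [abs_of_nonneg h, abs_of_nonneg (Real.arsinh_nonneg_iff.2 h)]
  · rw [abs_of_nonpos h, abs_of_nonpos (Real.arsinh_nonpos_iff.2 h), Real.arsinh_neg]

lemma arsinh_mul_self (y : ℝ) : Real.arsinh y * y = |y| * Real.arsinh |y| := by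
  rcases le_total 0 y with h | h
  · rw [abs_of_nonneg h, mul_comm]
  · rw [abs_of_nonpos h, Real.arsinh_neg]; ring

lemma cosh2Conj_le_abs_mul_arsinh (y : ℝ) : cosh2Conj y ≤ |y| * Real.arsinh |y| := by
  rw [cosh2Conj_eq, ← arsinh_mul_self]
  linarith [cosh2_nonneg (Real.arsinh y)]

lemma four_mul_cosh2_half_le (t : ℝ) : 4 * cosh2 (t / 2) ≤ cosh2 t := by
  have h1 := Real.one_le_cosh (t / 2)
  have h2 : Real.cosh t = 2 * Real.cosh (t / 2) ^ 2 - 1 := by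
    have := Real.cosh_two_mul (t / 2)
    have h3 := Real.cosh_sq (t / 2)
    rw [show 2 * (t / 2) = t by ring] at this
    linarith
  rw [cosh2, cosh2, h2]
  nlinarith

/-- A lower bound for the conjugate function by its main term: it is the Young inequality at
half of the point where equality holds. -/
lemma abs_mul_arsinh_le (y : ℝ) : |y| * Real.arsinh |y| ≤ 4 * cosh2Conj y := by
  have h1 := mul_le_cosh2Conj_add_cosh2 (Real.arsinh y / 2) y
  have h2 := four_mul_cosh2_half_le (Real.arsinh y)
  have h3 := cosh2Conj_nonneg y
  rw [← arsinh_mul_self]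
  rw [cosh2Conj_eq] at h1 h3 ⊢
  linarith

lemma cosh2Conj_le_of_abs_le {x y : ℝ} (h : |x| ≤ |y|) : cosh2Conj x ≤ cosh2Conj y := by
  have h1 := mul_le_cosh2Conj_add_cosh2 |Real.arsinh x| |y|
  have h2 : cosh2Conj |y| = cosh2Conj y := by
    rw [cosh2Conj_eq, cosh2Conj_eq, arsinh_mul_self, arsinh_mul_self, abs_abs, arsinh_abs, cosh2,
      Real.cosh_abs, cosh2]
  have h3 : |x| * |Real.arsinh x| ≤ |y| * |Real.arsinh x| :=
    mul_le_mul_of_nonneg_right h (abs_nonneg _)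
  have h4 : cosh2 |Real.arsinh x| = cosh2 (Real.arsinh x) := by
    rw [cosh2, Real.cosh_abs, cosh2]
  rw [cosh2Conj_eq x, arsinh_mul_self, arsinh_abs]
  linarith

lemma continuous_cosh2 : Continuous cosh2 := Real.continuous_cosh.sub continuous_const

lemma continuous_cosh2Conj : Continuous cosh2Conj := by
  unfold cosh2Conj
  have := Real.continuous_arsinh
  fun_prop

/-- `Φ` is nonnegative, and its restriction to a ray lies below the chords from the origin. This
is all that scaling arguments in `L^Φ` use of the convexity of `Φ`. -/
structure StarShaped (Φ : ℝ → ℝ) : Prop where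
  nonneg : ∀ x, 0 ≤ Φ x
  mul_le : ∀ a x, 0 ≤ a → a ≤ 1 → Φ (a * x) ≤ a * Φ x

lemma starShaped_cosh2 : StarShaped cosh2 where
  nonneg := cosh2_nonneg
  mul_le a x h0 h1 := by
    have h2 := cosh_add_sinh_mul_sub_le x (a * x)
    have h3 := cosh_add_sinh_mul_sub_le 0 (a * x)
    rw [Real.cosh_zero] at h3
    rw [cosh2, cosh2]
    nlinarith

lemma starShaped_cosh2Conj : StarShaped cosh2Conj where
  nonneg := cosh2Conj_nonneg
  mul_le a x h0 h1 := by
    have h2 := mul_le_cosh2Conj_add_cosh2 (Real.arsinh (a * x)) x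
    have h3 := cosh2_nonneg (Real.arsinh (a * x))
    rw [cosh2Conj_eq (a * x)]
    nlinarith

/-- Multiplication by `b ≥ 1` shifts `arsinh` by at most `log b`. -/
lemma arsinh_mul_le {a b : ℝ} (hb : 1 ≤ b) :
    Real.arsinh (b * a) ≤ Real.arsinh a + Real.log b := by
  have hb0 : 0 < b := by linarith
  have h : b * a ≤ Real.sinh (Real.arsinh a + Real.log b) := by
    have hs := Real.sinh_arsinh a
    have hc := Real.cosh_pos (Real.arsinh a)
    have hi : b⁻¹ ≤ b := (inv_le_one_of_one_le₀ hb).trans hb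
    rw [Real.sinh_add, hs, Real.cosh_log hb0, Real.sinh_log hb0]
    have h1 : a ≤ Real.cosh (Real.arsinh a) := by
      rw [← hs, Real.arsinh_sinh]; exact (Real.sinh_lt_cosh _).le
    nlinarith
  rw [← Real.sinh_le_sinh, Real.sinh_arsinh]
  exact h

lemma log_two_mul_le_arsinh {x : ℝ} (hx : 0 < x) : Real.log (2 * x) ≤ Real.arsinh x := by
  rw [Real.log_le_iff_le_exp (by linarith), Real.exp_arsinh]
  have : x ≤ √(1 + x ^ 2) := Real.le_sqrt_of_sq_le (by linarith)
  linarith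

/-! ### Modular estimates in Orlicz spaces -/

/-- Scaling of the modular. -/
lemma StarShaped.lintegral_le {Φ : ℝ → ℝ} (hΦ : StarShaped Φ) (ν : Measure Ω) (v : Ω → ℝ) {a : ℝ}
    (h0 : 0 ≤ a) (h1 : a ≤ 1) :
    ∫⁻ x, ENNReal.ofReal (Φ (a * v x)) ∂ν ≤
      ENNReal.ofReal a * ∫⁻ x, ENNReal.ofReal (Φ (v x)) ∂ν := by
  rw [← lintegral_const_mul' _ _ ENNReal.ofReal_ne_top]
  refine lintegral_mono fun x => ?_
  rw [← ENNReal.ofReal_mul h0]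
  exact ENNReal.ofReal_le_ofReal (hΦ.mul_le a _ h0 h1)

lemma StarShaped.lintegral_mono_left {Φ : ℝ → ℝ} (hΦ : StarShaped Φ) (ν : Measure Ω)
    (v : Ω → ℝ) {a b : ℝ} (h0 : 0 ≤ a) (h1 : a ≤ b) :
    ∫⁻ x, ENNReal.ofReal (Φ (a * v x)) ∂ν ≤ ∫⁻ x, ENNReal.ofReal (Φ (b * v x)) ∂ν := by
  rcases h0.eq_or_lt with rfl | ha
  · have := hΦ.lintegral_le ν (fun x => b * v x) le_rfl zero_le_one
    simpa using this.trans (by simp)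
  have hb : 0 < b := ha.trans_le h1
  have h2 : a / b ≤ 1 := (div_le_one hb).2 h1
  have h3 := hΦ.lintegral_le ν (fun x => b * v x) (div_nonneg h0 hb.le) h2
  have h4 : ∀ x, a / b * (b * v x) = a * v x := fun x => by field_simp
  simp only [h4] at h3
  refine h3.trans (mul_le_of_le_one_left' ?_)
  exact ENNReal.ofReal_le_one.2 h2

/-- Division by `1 + A` brings a modular that is at most `A` below `1`. -/
lemma StarShaped.lintegral_inv_le_one {Φ : ℝ → ℝ} (hΦ : StarShaped Φ) (ν : Measure Ω)
    (v : Ω → ℝ) {A : ℝ} (hA : 0 ≤ A)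
    (h : ∫⁻ x, ENNReal.ofReal (Φ (v x)) ∂ν ≤ ENNReal.ofReal A) :
    ∫⁻ x, ENNReal.ofReal (Φ ((1 + A)⁻¹ * v x)) ∂ν ≤ 1 := by
  have h1 : (1 + A)⁻¹ ≤ 1 := inv_le_one_of_one_le₀ (by linarith)
  refine (hΦ.lintegral_le ν v (by positivity) h1).trans ?_
  refine (mul_le_mul_right h _).trans ?_
  rw [← ENNReal.ofReal_mul (by positivity), ENNReal.ofReal_le_one, inv_mul_le_one₀ (by positivity)]
  linarith

lemma MemOrlicz.exists_le_one {Φ : ℝ → ℝ} (hΦ : StarShaped Φ) {ν : Measure Ω} {v : Ω → ℝ}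
    (hv : MemOrlicz Φ ν v) :
    ∃ ρ : ℝ, 0 < ρ ∧ ∫⁻ x, ENNReal.ofReal (Φ (ρ⁻¹ * v x)) ∂ν ≤ 1 := by
  obtain ⟨-, ρ, hρ, h⟩ := hv
  set A := ∫⁻ x, ENNReal.ofReal (Φ (ρ⁻¹ * v x)) ∂ν
  refine ⟨ρ * (1 + A.toReal), by positivity, ?_⟩
  have := hΦ.lintegral_inv_le_one ν (fun x => ρ⁻¹ * v x) (A := A.toReal) ENNReal.toReal_nonneg
    (ENNReal.ofReal_toReal h.ne).ge
  simpa only [mul_inv_rev, mul_assoc] using this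

lemma luxNorm_le {Φ : ℝ → ℝ} {ν : Measure Ω} {v : Ω → ℝ} {ρ : ℝ} (hρ : 0 < ρ)
    (h : ∫⁻ x, ENNReal.ofReal (Φ (ρ⁻¹ * v x)) ∂ν ≤ 1) : luxNorm Φ ν v ≤ ρ :=
  csInf_le ⟨0, fun _ h => h.1.le⟩ ⟨hρ, h⟩

/-- Above the Luxemburg norm the modular is at most `1`. -/
lemma MemOrlicz.lintegral_le_one {Φ : ℝ → ℝ} (hΦ : StarShaped Φ) {ν : Measure Ω} {v : Ω → ℝ}
    (hv : MemOrlicz Φ ν v) {ρ : ℝ} (h : luxNorm Φ ν v < ρ) :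
    ∫⁻ x, ENNReal.ofReal (Φ (ρ⁻¹ * v x)) ∂ν ≤ 1 := by
  obtain ⟨σ, ⟨hσ, h1⟩, h2⟩ := exists_lt_of_csInf_lt (hv.exists_le_one hΦ) h
  refine (hΦ.lintegral_mono_left ν v ?_ ?_).trans h1
  · exact inv_nonneg.2 (hσ.trans h2).le
  · exact inv_anti₀ hσ h2.le

/-- Multiplication by `m` maps the unit modular ball of `L^Φ(ν₁)` into a multiple of that of
`L^Φ(ν₂)`. -/
def ModularBounded (Φ : ℝ → ℝ) (ν₁ ν₂ : Measure Ω) (m : Ω → ℝ) : Prop :=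
  ∃ C : ℝ, 0 < C ∧ ∀ v : Ω → ℝ, AEMeasurable v ν₁ →
    ∫⁻ x, ENNReal.ofReal (Φ (v x)) ∂ν₁ ≤ 1 →
      ∫⁻ x, ENNReal.ofReal (Φ (C⁻¹ * (m x * v x))) ∂ν₂ ≤ 1

/-- It suffices to bound the modular by any finite constant, after any scaling. -/
lemma StarShaped.modularBounded {Φ : ℝ → ℝ} (hΦ : StarShaped Φ) {ν₁ ν₂ : Measure Ω} {m : Ω → ℝ}
    {s : ℝ} (hs : 0 < s) {A : ℝ≥0∞} (hA : A ≠ ∞)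
    (h : ∀ v : Ω → ℝ, AEMeasurable v ν₁ → ∫⁻ x, ENNReal.ofReal (Φ (v x)) ∂ν₁ ≤ 1 →
      ∫⁻ x, ENNReal.ofReal (Φ (s⁻¹ * (m x * v x))) ∂ν₂ ≤ A) :
    ModularBounded Φ ν₁ ν₂ m := by
  refine ⟨s * (1 + A.toReal), by positivity, fun v hv h1 => ?_⟩
  have := hΦ.lintegral_inv_le_one ν₂ (fun x => s⁻¹ * (m x * v x)) (A := A.toReal)
    ENNReal.toReal_nonneg ((h v hv h1).trans (ENNReal.ofReal_toReal hA).ge)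
  simpa only [mul_inv_rev, mul_assoc] using this

/-- A modular bound yields the boundedness of the multiplication operator. -/
lemma ModularBounded.exists_luxNorm_le {Φ : ℝ → ℝ} (hΦ : StarShaped Φ) {ν₁ ν₂ : Measure Ω}
    {m : Ω → ℝ} (hm : AEMeasurable m ν₂) (hac : ν₂ ≪ ν₁) (h : ModularBounded Φ ν₁ ν₂ m) :
    ∃ C : ℝ, 0 < C ∧ ∀ v : Ω → ℝ, MemOrlicz Φ ν₁ v →
      MemOrlicz Φ ν₂ (fun x => m x * v x) ∧
        luxNorm Φ ν₂ (fun x => m x * v x) ≤ C * luxNorm Φ ν₁ v := by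
  obtain ⟨C, hC, h⟩ := h
  refine ⟨C, hC, fun v hv => ?_⟩
  have key : ∀ ρ : ℝ, 0 < ρ → ∫⁻ x, ENNReal.ofReal (Φ (ρ⁻¹ * v x)) ∂ν₁ ≤ 1 →
      ∫⁻ x, ENNReal.ofReal (Φ ((C * ρ)⁻¹ * (m x * v x))) ∂ν₂ ≤ 1 := by
    intro ρ hρ h1
    have h2 := h (fun x => ρ⁻¹ * v x) (hv.1.const_mul _) h1
    have h3 : ∀ x, C⁻¹ * (m x * (ρ⁻¹ * v x)) = (C * ρ)⁻¹ * (m x * v x) := fun x => by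
      rw [mul_inv_rev]; ring
    simpa only [h3] using h2
  have hne := hv.exists_le_one hΦ
  constructor
  · obtain ⟨ρ, hρ, h1⟩ := hne
    exact ⟨hm.mul (hv.1.mono_ac hac), C * ρ, by positivity,
      (key ρ hρ h1).trans_lt ENNReal.one_lt_top⟩
  · rw [← div_le_iff₀' hC]
    refine le_csInf hne fun ρ ⟨hρ, h1⟩ => ?_
    rw [div_le_iff₀' hC]
    exact luxNorm_le (by positivity) (key ρ hρ h1)

lemma luxNorm_congr {Φ : ℝ → ℝ} {ν : Measure Ω} {v w : Ω → ℝ} (h : v =ᵐ[ν] w) :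
    luxNorm Φ ν v = luxNorm Φ ν w := by
  have h1 : ∀ ρ : ℝ, ∫⁻ x, ENNReal.ofReal (Φ (ρ⁻¹ * v x)) ∂ν =
      ∫⁻ x, ENNReal.ofReal (Φ (ρ⁻¹ * w x)) ∂ν := fun ρ =>
    lintegral_congr_ae (by filter_upwards [h] with x hx; rw [hx])
  simp only [luxNorm, h1]

lemma MemOrlicz.congr {Φ : ℝ → ℝ} {ν : Measure Ω} {v w : Ω → ℝ} (hv : MemOrlicz Φ ν v)
    (h : v =ᵐ[ν] w) : MemOrlicz Φ ν w := by
  obtain ⟨h0, ρ, hρ, h1⟩ := hv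
  refine ⟨h0.congr h, ρ, hρ, ?_⟩
  refine lt_of_eq_of_lt (lintegral_congr_ae ?_) h1
  filter_upwards [h] with x hx
  rw [hx]

/-- The Orlicz space of `cosh2` is closed under subtraction. -/
lemma MemOrlicz.sub {ν : Measure Ω} {v w : Ω → ℝ} (hv : MemOrlicz cosh2 ν v)
    (hw : MemOrlicz cosh2 ν w) : MemOrlicz cosh2 ν (fun x => v x - w x) := by
  obtain ⟨hv0, ρ, hρ, hv1⟩ := hv
  obtain ⟨hw0, σ, hσ, hw1⟩ := hw
  refine ⟨hv0.sub hw0, 2 * max ρ σ, by positivity, ?_⟩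
  have hmax : 0 < max ρ σ := lt_max_of_lt_left hρ
  have hm : AEMeasurable (fun x => ENNReal.ofReal (cosh2 (ρ⁻¹ * v x))) ν :=
    (continuous_cosh2.measurable.comp_aemeasurable (hv0.const_mul _)).ennreal_ofReal
  refine (lintegral_mono fun x => ?_).trans_lt
    ((lintegral_add_left' hm fun x => ENNReal.ofReal (cosh2 (σ⁻¹ * w x))).trans_lt
      (ENNReal.add_lt_top.2 ⟨hv1, hw1⟩))
  rw [← ENNReal.ofReal_add (cosh2_nonneg _) (cosh2_nonneg _)]
  refine ENNReal.ofReal_le_ofReal ?_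
  have h1 : |(2 * max ρ σ)⁻¹ * (v x - w x)| ≤ max |ρ⁻¹ * v x| |σ⁻¹ * w x| := by
    have a1 : |(max ρ σ)⁻¹ * v x| ≤ |ρ⁻¹ * v x| := by
      rw [abs_mul, abs_mul, abs_of_pos (inv_pos.2 hmax), abs_of_pos (inv_pos.2 hρ)]
      exact mul_le_mul_of_nonneg_right (inv_anti₀ hρ (le_max_left _ _)) (abs_nonneg _)
    have a2 : |(max ρ σ)⁻¹ * w x| ≤ |σ⁻¹ * w x| := by
      rw [abs_mul, abs_mul, abs_of_pos (inv_pos.2 hmax), abs_of_pos (inv_pos.2 hσ)]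
      exact mul_le_mul_of_nonneg_right (inv_anti₀ hσ (le_max_right _ _)) (abs_nonneg _)
    have a3 := abs_sub ((max ρ σ)⁻¹ * v x) ((max ρ σ)⁻¹ * w x)
    have a4 : (2 * max ρ σ)⁻¹ * (v x - w x) =
        ((max ρ σ)⁻¹ * v x - (max ρ σ)⁻¹ * w x) / 2 := by
      rw [mul_inv_rev]; ring
    rw [a4, abs_div, abs_two]
    have := a1.trans (le_max_left _ |σ⁻¹ * w x|)
    have := a2.trans (le_max_right |ρ⁻¹ * v x| _)
    linarith
  rcases le_max_iff.1 h1 with h | h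
  · exact (cosh2_le_of_abs_le h).trans (le_add_of_nonneg_right (cosh2_nonneg _))
  · exact (cosh2_le_of_abs_le h).trans (le_add_of_nonneg_left (cosh2_nonneg _))

/-! ### Exponential changes of measure -/

/-- `Q = e^f · P`. -/
structure IsTilt (P Q : Measure Ω) (f : Ω → ℝ) : Prop where
  aemeasurable : AEMeasurable f P
  eq_withDensity : Q = P.withDensity fun x => ENNReal.ofReal (Real.exp (f x))

lemma IsTilt.aemeasurable_exp {P Q : Measure Ω} {f : Ω → ℝ} (h : IsTilt P Q f) :
    AEMeasurable (fun x => ENNReal.ofReal (Real.exp (f x))) P :=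
  (Real.measurable_exp.comp_aemeasurable h.aemeasurable).ennreal_ofReal

lemma IsTilt.lintegral_eq {P Q : Measure Ω} {f : Ω → ℝ} (h : IsTilt P Q f) (g : Ω → ℝ≥0∞) :
    ∫⁻ x, g x ∂Q = ∫⁻ x, ENNReal.ofReal (Real.exp (f x)) * g x ∂P := by
  rw [h.eq_withDensity, lintegral_withDensity_eq_lintegral_mul_non_measurable₀ _
    h.aemeasurable_exp (ae_of_all _ fun _ => ENNReal.ofReal_lt_top)]
  rfl

lemma IsTilt.lintegral_ofReal {P Q : Measure Ω} {f : Ω → ℝ} (h : IsTilt P Q f) (g : Ω → ℝ) :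
    ∫⁻ x, ENNReal.ofReal (g x) ∂Q = ∫⁻ x, ENNReal.ofReal (Real.exp (f x) * g x) ∂P := by
  rw [h.lintegral_eq]
  simp only [ENNReal.ofReal_mul (Real.exp_pos _).le]

lemma IsTilt.ac {P Q : Measure Ω} {f : Ω → ℝ} (h : IsTilt P Q f) : Q ≪ P :=
  h.eq_withDensity ▸ withDensity_absolutelyContinuous _ _

lemma IsTilt.ac' {P Q : Measure Ω} {f : Ω → ℝ} (h : IsTilt P Q f) : P ≪ Q :=
  h.eq_withDensity ▸ withDensity_absolutelyContinuous' h.aemeasurable_exp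
    (ae_of_all _ fun _ => by simp [Real.exp_pos])

lemma IsTilt.symm {P Q : Measure Ω} {f : Ω → ℝ} (h : IsTilt P Q f) :
    IsTilt Q P (fun x => -f x) where
  aemeasurable := (h.aemeasurable.mono_ac h.ac).neg
  eq_withDensity := by
    have h1 := withDensity_inv_same₀ h.aemeasurable_exp
      (ae_of_all _ fun x => by simp [Real.exp_pos]) (ae_of_all _ fun _ => ENNReal.ofReal_ne_top)
    rw [← h.eq_withDensity] at h1
    rw [← h1]
    congr 1
    ext x
    rw [Real.exp_neg, ENNReal.ofReal_inv_of_pos (Real.exp_pos _)]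

/-- Some positive exponential moment of `g` is finite. -/
def HasExpMoment (ν : Measure Ω) (g : Ω → ℝ) : Prop :=
  ∃ ε : ℝ, 0 < ε ∧ momentFn ν (fun x => ε * g x) < ∞

lemma IsTilt.momentFn_eq {P Q : Measure Ω} {f : Ω → ℝ} (h : IsTilt P Q f) (a : ℝ) :
    momentFn Q (fun x => a * f x) = momentFn P (fun x => (1 + a) * f x) := by
  simp only [momentFn, h.lintegral_ofReal, ← Real.exp_add, add_mul, one_mul]

lemma aemeasurable_ofReal_comp {ν : Measure Ω} {Φ : ℝ → ℝ} (hΦ : Continuous Φ) {v : Ω → ℝ}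
    (hv : AEMeasurable v ν) : AEMeasurable (fun x => ENNReal.ofReal (Φ (v x))) ν :=
  (hΦ.measurable.comp_aemeasurable hv).ennreal_ofReal

lemma lintegral_exp_abs_le (ν : Measure Ω) [IsProbabilityMeasure ν] (v : Ω → ℝ) :
    ∫⁻ x, ENNReal.ofReal (Real.exp |v x|) ∂ν ≤
      2 * ∫⁻ x, ENNReal.ofReal (cosh2 (v x)) ∂ν + 2 := by
  calc ∫⁻ x, ENNReal.ofReal (Real.exp |v x|) ∂ν
      ≤ ∫⁻ x, (2 * ENNReal.ofReal (cosh2 (v x)) + 2) ∂ν := by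
        refine lintegral_mono fun x => ?_
        refine (ENNReal.ofReal_le_ofReal (exp_abs_le_two_mul_cosh2_add_two _)).trans ?_
        rw [ENNReal.ofReal_add (by have := cosh2_nonneg (v x); positivity) (by norm_num),
          ENNReal.ofReal_mul (by norm_num), ENNReal.ofReal_ofNat]
    _ = _ := by
        rw [lintegral_add_right _ measurable_const, lintegral_const_mul' _ _ (by simp)]
        simp

lemma MemOrlicz.hasExpMoment {ν : Measure Ω} [IsProbabilityMeasure ν] {v : Ω → ℝ}
    (h : MemOrlicz cosh2 ν v) : HasExpMoment ν v := by
  obtain ⟨-, ρ, hρ, h1⟩ := h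
  refine ⟨ρ⁻¹, inv_pos.2 hρ, ?_⟩
  refine lt_of_le_of_lt (lintegral_mono fun x => ?_)
    ((lintegral_exp_abs_le ν fun x => ρ⁻¹ * v x).trans_lt ?_)
  · exact ENNReal.ofReal_le_ofReal (Real.exp_le_exp.2 (le_abs_self _))
  · exact ENNReal.add_lt_top.2 ⟨ENNReal.mul_lt_top (by simp) h1, by simp⟩

/-- The Young inequality for the conjugate exponents `1 + ε` and `(1 + ε) / ε`, up to constants. -/
lemma exp_add_mul_le {ε : ℝ} (hε : 0 < ε) (a b : ℝ) :
    Real.exp (a + ε / (1 + ε) * b) ≤ Real.exp ((1 + ε) * a) + Real.exp b := by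
  have e1 := Real.exp_pos b
  have e2 := Real.exp_pos ((1 + ε) * a)
  rcases le_total b ((1 + ε) * a) with h | h
  · have : a + ε / (1 + ε) * b ≤ (1 + ε) * a := by
      have := mul_le_mul_of_nonneg_left h (show 0 ≤ ε / (1 + ε) by positivity)
      rw [← mul_assoc, div_mul_cancel₀ _ (by positivity)] at this
      linarith
    linarith [Real.exp_le_exp.2 this]
  · have : a + ε / (1 + ε) * b ≤ b := by
      have h3 : a ≤ b / (1 + ε) := by rwa [le_div_iff₀' (by positivity)]
      have h4 : b = b / (1 + ε) + ε / (1 + ε) * b := by field_simp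
      linarith
    linarith [Real.exp_le_exp.2 this]

/-! ### Comparison of the spaces of `P` and of `e^f · P` -/

/-- If `f` has an exponential moment under `Q = e^f · P`, then `L^{cosh2}(P)` embeds in
`L^{cosh2}(Q)`. With `α = 1 + ε` and its conjugate exponent `s`, the integrand
`e^{|v| / s + f}` is at most `e^{|v|} + e^{α f}`. -/
lemma IsTilt.modularBounded_cosh2 {P Q : Measure Ω} [IsProbabilityMeasure P] {f : Ω → ℝ}
    (h : IsTilt P Q f) (hf : HasExpMoment Q f) : ModularBounded cosh2 P Q fun _ => 1 := by
  obtain ⟨ε, hε, hf⟩ := hf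
  rw [h.momentFn_eq] at hf
  refine starShaped_cosh2.modularBounded (s := (1 + ε) / ε) (by positivity)
    (A := (2 * 1 + 2) + momentFn P fun x => (1 + ε) * f x)
    (ENNReal.add_lt_top.2 ⟨by simp, hf⟩).ne fun v hv h1 => ?_
  have hm : AEMeasurable (fun x => ENNReal.ofReal (Real.exp |v x|)) P :=
    aemeasurable_ofReal_comp (Φ := fun t => Real.exp |t|) (by fun_prop) hv
  rw [h.lintegral_ofReal]
  calc ∫⁻ x, ENNReal.ofReal (Real.exp (f x) * cosh2 (((1 + ε) / ε)⁻¹ * (1 * v x))) ∂P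
      ≤ ∫⁻ x, (ENNReal.ofReal (Real.exp |v x|) + ENNReal.ofReal (Real.exp ((1 + ε) * f x))) ∂P := by
        refine lintegral_mono fun x => ?_
        rw [← ENNReal.ofReal_add (Real.exp_pos _).le (Real.exp_pos _).le]
        refine ENNReal.ofReal_le_ofReal ?_
        refine (mul_le_mul_of_nonneg_left (cosh2_le_exp_abs _) (Real.exp_pos _).le).trans ?_
        have e : |((1 + ε) / ε)⁻¹ * (1 * v x)| = ε / (1 + ε) * |v x| := by
          rw [one_mul, abs_mul, inv_div, abs_of_pos (by positivity)]
        rw [← Real.exp_add, e, add_comm (Real.exp |v x|)]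
        exact exp_add_mul_le hε _ _
    _ = ∫⁻ x, ENNReal.ofReal (Real.exp |v x|) ∂P + momentFn P fun x => (1 + ε) * f x :=
        lintegral_add_left' hm _
    _ ≤ _ := by
        gcongr
        exact (lintegral_exp_abs_le P v).trans (by gcongr)

/-- If `-f` has an exponential moment under `P`, then multiplication by `e^{-f}` maps
`L^{cosh2Conj}(P)` into `L^{cosh2Conj}(e^f · P)`: the modular of `e^{-f} v` is governed by
`∫ |v| arsinh (e^{-f} |v|) dP`, and the shift of `arsinh` caused by `e^{-f}` is handled by the
Young inequality. -/
lemma IsTilt.modularBounded_cosh2Conj {P Q : Measure Ω} [IsProbabilityMeasure P] {f : Ω → ℝ}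
    (h : IsTilt P Q f) (hf : HasExpMoment P fun x => -f x) :
    ModularBounded cosh2Conj P Q fun x => Real.exp (-f x) := by
  obtain ⟨ε, hε, hf⟩ := hf
  refine starShaped_cosh2Conj.modularBounded (s := 1) one_pos
    (A := ENNReal.ofReal (4 + ε⁻¹) * 1 +
      (ENNReal.ofReal ε⁻¹ * momentFn P (fun x => ε * -f x) + ENNReal.ofReal ε⁻¹))
    (ENNReal.add_lt_top.2 ⟨by simp, ENNReal.add_lt_top.2
      ⟨ENNReal.mul_lt_top ENNReal.ofReal_lt_top hf, ENNReal.ofReal_lt_top⟩⟩).ne fun v hv h1 => ?_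
  have hm := aemeasurable_ofReal_comp continuous_cosh2Conj hv
  rw [h.lintegral_ofReal]
  calc ∫⁻ x, ENNReal.ofReal (Real.exp (f x) * cosh2Conj (1⁻¹ * (Real.exp (-f x) * v x))) ∂P
      ≤ ∫⁻ x, (ENNReal.ofReal (4 + ε⁻¹) * ENNReal.ofReal (cosh2Conj (v x)) +
          (ENNReal.ofReal ε⁻¹ * ENNReal.ofReal (Real.exp (ε * -f x)) +
            ENNReal.ofReal ε⁻¹)) ∂P := by
        refine lintegral_mono fun x => ?_
        have hi : 0 ≤ ε⁻¹ := by positivity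
        rw [← ENNReal.ofReal_mul (by positivity), ← ENNReal.ofReal_mul hi,
          ← ENNReal.ofReal_add (by positivity) hi, ← ENNReal.ofReal_add
          (mul_nonneg (by positivity) (cosh2Conj_nonneg _)) (by positivity)]
        refine ENNReal.ofReal_le_ofReal ?_
        rw [inv_one, one_mul]
        set r := Real.exp (-f x) with hr
        have hr0 : 0 < r := Real.exp_pos _
        have hfr : Real.exp (f x) * r = 1 := by rw [hr, ← Real.exp_add]; simp
        set g := max (-f x) 0
        have hg0 : 0 ≤ g := le_max_right _ _
        -- The factor `e^{-f}` inside `arsinh` costs at most `g`, the positive part of `-f`.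
        have b1 : Real.arsinh (r * |v x|) ≤ Real.arsinh |v x| + g := by
          calc Real.arsinh (r * |v x|) ≤ Real.arsinh (Real.exp g * |v x|) :=
                Real.arsinh_le_arsinh.2 (mul_le_mul_of_nonneg_right
                  (Real.exp_le_exp.2 (le_max_left _ _)) (abs_nonneg _))
            _ ≤ _ := by
                have := arsinh_mul_le (a := |v x|) (Real.one_le_exp hg0)
                rwa [Real.log_exp] at this
        have b2 : Real.exp (f x) * cosh2Conj (r * v x) ≤ |v x| * Real.arsinh (r * |v x|) := by
          have := cosh2Conj_le_abs_mul_arsinh (r * v x)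
          rw [abs_mul, abs_of_pos hr0] at this
          calc Real.exp (f x) * cosh2Conj (r * v x)
              ≤ Real.exp (f x) * (r * |v x| * Real.arsinh (r * |v x|)) :=
                mul_le_mul_of_nonneg_left this (Real.exp_pos _).le
            _ = (Real.exp (f x) * r) * (|v x| * Real.arsinh (r * |v x|)) := by ring
            _ = _ := by rw [hfr, one_mul]
        have b3 : |v x| * (Real.arsinh |v x| + g) ≤ 4 * cosh2Conj (v x) + |v x| * g := by
          linarith [abs_mul_arsinh_le (v x)]
        have b4 : |v x| * g ≤ ε⁻¹ * (cosh2Conj (v x) + (Real.exp (ε * -f x) + 1)) := by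
          have y1 := mul_le_cosh2Conj_add_cosh2 (ε * g) |v x|
          have y2 := cosh2Conj_le_of_abs_le (abs_abs (v x)).le
          have y3 : cosh2 (ε * g) ≤ Real.exp (ε * -f x) + 1 := by
            have := cosh2_le_exp_abs (ε * g)
            rw [abs_of_nonneg (by positivity)] at this
            rcases le_total (-f x) 0 with h2 | h2
            · have hg : g = 0 := max_eq_right h2
              rw [hg] at this ⊢
              simp only [mul_zero, Real.exp_zero] at this ⊢
              linarith [Real.exp_pos (ε * -f x)]
            · have hg : g = -f x := max_eq_left h2
              rw [hg] at this ⊢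
              linarith
          rw [le_inv_mul_iff₀ hε]
          linarith
        have b5 := mul_le_mul_of_nonneg_left b1 (abs_nonneg (v x))
        linarith
    _ = ENNReal.ofReal (4 + ε⁻¹) * ∫⁻ x, ENNReal.ofReal (cosh2Conj (v x)) ∂P +
          (ENNReal.ofReal ε⁻¹ * momentFn P (fun x => ε * -f x) + ENNReal.ofReal ε⁻¹) := by
        rw [lintegral_add_left' (hm.const_mul _), lintegral_add_right _ measurable_const,
          lintegral_const_mul' _ _ ENNReal.ofReal_ne_top,
          lintegral_const_mul' _ _ ENNReal.ofReal_ne_top]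
        simp [momentFn]
    _ ≤ _ := by gcongr

/-- If `L^{cosh2}(P)` is contained in `L^{cosh2}(Q)`, `Q = e^f · P`, then `f` has an exponential
moment under `Q`, because the positive part of `f` belongs to `L^{cosh2}(P)`. -/
lemma IsTilt.hasExpMoment_of_memOrlicz_imp {P Q : Measure Ω} [IsProbabilityMeasure Q]
    {f : Ω → ℝ} (h : IsTilt P Q f)
    (hsub : ∀ v : Ω → ℝ, MemOrlicz cosh2 P v → MemOrlicz cosh2 Q v) : HasExpMoment Q f := by
  have hm : AEMeasurable (fun x => max (f x) 0) P := h.aemeasurable.max aemeasurable_const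
  have h1 : MemOrlicz cosh2 P fun x => max (f x) 0 := by
    refine ⟨hm, 1, one_pos, ?_⟩
    refine lt_of_le_of_lt (b := Q univ) ?_ (by simp)
    rw [← lintegral_one, h.lintegral_eq]
    refine lintegral_mono fun x => ?_
    rw [mul_one]
    refine ENNReal.ofReal_le_ofReal ?_
    rw [inv_one, one_mul]
    change cosh2 (max (f x) 0) ≤ Real.exp (f x)
    rcases le_total (f x) 0 with h2 | h2
    · rw [max_eq_right h2]
      simpa [cosh2] using (Real.exp_pos _).le
    · rw [max_eq_left h2]
      simpa [abs_of_nonneg h2] using cosh2_le_exp_abs (f x)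
  obtain ⟨ε, hε, h2⟩ := (hsub _ h1).hasExpMoment
  refine ⟨ε, hε, lt_of_le_of_lt (lintegral_mono fun x => ?_) h2⟩
  exact ENNReal.ofReal_le_ofReal
    (Real.exp_le_exp.2 (mul_le_mul_of_nonneg_left (le_max_left _ _) hε.le))

/-- The pointwise estimate which extracts `log (e^{-f})` from the modular of `e^{-f} v`. -/
lemma mul_max_neg_le {f v D : ℝ} (hv : 0 ≤ v) (hD : 0 < D) :
    v * max (-f) 0 ≤ 4 * D * (Real.exp f * cosh2Conj (D⁻¹ * (Real.exp (-f) * v))) +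
      (cosh2Conj v + (cosh2 (Real.log D) + 1)) := by
  have p1 := cosh2Conj_nonneg (D⁻¹ * (Real.exp (-f) * v))
  have p2 := cosh2Conj_nonneg v
  have p3 := cosh2_nonneg (Real.log D)
  have p4 := Real.exp_pos f
  have p5 : 0 ≤ 4 * D * (Real.exp f * cosh2Conj (D⁻¹ * (Real.exp (-f) * v))) := by positivity
  rcases hv.eq_or_lt with rfl | hv
  · rw [zero_mul]; linarith
  rcases le_total (-f) 0 with hf | hf
  · rw [max_eq_right hf, mul_zero]; linarith
  rw [max_eq_left hf]
  set y := D⁻¹ * (Real.exp (-f) * v) with hy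
  have hy0 : 0 < y := by positivity
  have h1 : Real.log (2 * y) = Real.log 2 + (-f) + Real.log v - Real.log D := by
    rw [hy, Real.log_mul two_ne_zero hy0.ne', Real.log_mul (by positivity) (by positivity),
      Real.log_mul (by positivity) (by positivity), Real.log_inv, Real.log_exp]
    ring
  have h2 := log_two_mul_le_arsinh hy0
  have h3 : v * -Real.log v ≤ 1 := by
    have := mul_le_mul_of_nonneg_left (Real.log_le_sub_one_of_pos (inv_pos.2 hv)) hv.le
    rw [Real.log_inv, mul_sub, mul_inv_cancel₀ hv.ne'] at this
    linarith
  have h4 : v * Real.arsinh y ≤ 4 * D * (Real.exp f * cosh2Conj y) := by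
    have := abs_mul_arsinh_le y
    rw [abs_of_pos hy0] at this
    have hvy : v = D * Real.exp f * y := by
      rw [hy, Real.exp_neg]; field_simp
    calc v * Real.arsinh y = D * Real.exp f * (y * Real.arsinh y) := by
          conv_lhs => rw [hvy]
          ring
      _ ≤ D * Real.exp f * (4 * cosh2Conj y) := mul_le_mul_of_nonneg_left this (by positivity)
      _ = _ := by ring
  have h5 := mul_le_cosh2Conj_add_cosh2 (Real.log D) v
  have h6 : 0 ≤ v * Real.log 2 := mul_nonneg hv.le (Real.log_nonneg one_le_two)
  have h7 := mul_le_mul_of_nonneg_left (h1 ▸ h2) hv.le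
  linarith

/-- If multiplication by `e^{-f}` is bounded from `L^{cosh2Conj}(P)` to
`L^{cosh2Conj}(e^f · P)`, then `-f` has an exponential moment under `P`.

With `g` the positive part of `-f`, boundedness gives `∫ v g dP ≤ K (1 + ∫ cosh2Conj(v) dP)` for
bounded `v ≥ 0`. At `v = sinh h`, where `h` is a truncation of `g / K`, the Young inequality is an
equality, and what remains is `∫ cosh2(h) dP ≤ 1`. -/
lemma IsTilt.hasExpMoment_of_luxNorm_le {P Q : Measure Ω} [IsProbabilityMeasure P]
    {f : Ω → ℝ} (h : IsTilt P Q f) {C : ℝ} (hC : 0 < C)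
    (hop : ∀ v : Ω → ℝ, MemOrlicz cosh2Conj P v →
      MemOrlicz cosh2Conj Q (fun x => Real.exp (-f x) * v x) ∧
        luxNorm cosh2Conj Q (fun x => Real.exp (-f x) * v x) ≤ C * luxNorm cosh2Conj P v) :
    HasExpMoment P fun x => -f x := by
  set D := C + 1 with hD
  have hD0 : 0 < D := by positivity
  set g : Ω → ℝ := fun x => max (-f x) 0 with hg
  have hg0 : ∀ x, 0 ≤ g x := fun x => le_max_right _ _
  have hgm : AEMeasurable g P := h.aemeasurable.neg.max aemeasurable_const
  set K := 4 * D + (1 + (cosh2 (Real.log D) + 1)) with hK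
  have hL := cosh2_nonneg (Real.log D)
  have hK0 : 0 < K := by positivity
  have unit : ∀ v : Ω → ℝ, AEMeasurable v P → (∀ x, 0 ≤ v x) →
      ∫⁻ x, ENNReal.ofReal (cosh2Conj (v x)) ∂P ≤ 1 →
        ∫⁻ x, ENNReal.ofReal (v x * g x) ∂P ≤ ENNReal.ofReal K := by
    intro v hv hv0 h1
    have hmem : MemOrlicz cosh2Conj P v :=
      ⟨hv, 1, one_pos, by simpa using h1.trans_lt ENNReal.one_lt_top⟩
    have hnorm : luxNorm cosh2Conj P v ≤ 1 := luxNorm_le one_pos (by simpa using h1)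
    obtain ⟨hmem', hle⟩ := hop v hmem
    have h2 := hmem'.lintegral_le_one starShaped_cosh2Conj (ρ := D) (by nlinarith)
    have hm1 := aemeasurable_ofReal_comp continuous_cosh2Conj hv
    calc ∫⁻ x, ENNReal.ofReal (v x * g x) ∂P
        ≤ ∫⁻ x, (ENNReal.ofReal (4 * D) * ENNReal.ofReal
              (Real.exp (f x) * cosh2Conj (D⁻¹ * (Real.exp (-f x) * v x))) +
            (ENNReal.ofReal (cosh2Conj (v x)) +
              ENNReal.ofReal (cosh2 (Real.log D) + 1))) ∂P := by
          refine lintegral_mono fun x => ?_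
          have q1 := cosh2Conj_nonneg (D⁻¹ * (Real.exp (-f x) * v x))
          have q2 := cosh2Conj_nonneg (v x)
          rw [← ENNReal.ofReal_mul (by positivity), ← ENNReal.ofReal_add q2 (by positivity),
            ← ENNReal.ofReal_add (by positivity) (by positivity)]
          exact ENNReal.ofReal_le_ofReal (mul_max_neg_le (hv0 x) hD0)
      _ = ENNReal.ofReal (4 * D) * ∫⁻ x, ENNReal.ofReal
              (cosh2Conj (D⁻¹ * (Real.exp (-f x) * v x))) ∂Q +
            (∫⁻ x, ENNReal.ofReal (cosh2Conj (v x)) ∂P +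
              ENNReal.ofReal (cosh2 (Real.log D) + 1)) := by
          rw [lintegral_add_right' _ (hm1.add_const _), lintegral_add_left' hm1,
            lintegral_const_mul' _ _ ENNReal.ofReal_ne_top, h.lintegral_ofReal]
          simp
      _ ≤ ENNReal.ofReal (4 * D) * 1 + (1 + ENNReal.ofReal (cosh2 (Real.log D) + 1)) := by
          gcongr
      _ = ENNReal.ofReal K := by
          rw [mul_one, hK, ← ENNReal.ofReal_one, ← ENNReal.ofReal_add zero_le_one (by positivity),
            ← ENNReal.ofReal_add (by positivity) (by positivity)]
  have scaled : ∀ v : Ω → ℝ, AEMeasurable v P → (∀ x, 0 ≤ v x) → ∀ S : ℝ, 0 ≤ S →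
      ∫⁻ x, ENNReal.ofReal (cosh2Conj (v x)) ∂P = ENNReal.ofReal S →
        ∫⁻ x, ENNReal.ofReal (K⁻¹ * (v x * g x)) ∂P ≤ 1 + ENNReal.ofReal S := by
    intro v hv hv0 S hS h1
    have h2 := unit (fun x => (1 + S)⁻¹ * v x) (hv.const_mul _)
      (fun x => mul_nonneg (by positivity) (hv0 x))
      (starShaped_cosh2Conj.lintegral_inv_le_one P v hS h1.le)
    have h3 : ∀ x, K⁻¹ * (v x * g x) = (1 + S) * K⁻¹ * ((1 + S)⁻¹ * v x * g x) := fun x => by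
      field_simp
    simp only [h3]
    simp only [ENNReal.ofReal_mul (show 0 ≤ (1 + S) * K⁻¹ by positivity)]
    rw [lintegral_const_mul' _ _ ENNReal.ofReal_ne_top]
    refine (mul_le_mul_right h2 _).trans ?_
    rw [← ENNReal.ofReal_mul (by positivity), inv_mul_cancel_right₀ hK0.ne',
      ENNReal.ofReal_add zero_le_one hS, ENNReal.ofReal_one]
  have trunc : ∀ n : ℕ, ∫⁻ x, ENNReal.ofReal (cosh2 (K⁻¹ * min (g x) n)) ∂P ≤ 1 := by
    intro n
    set t : Ω → ℝ := fun x => K⁻¹ * min (g x) n with ht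
    have htm : AEMeasurable t P := (hgm.min aemeasurable_const).const_mul _
    have ht0 : ∀ x, 0 ≤ t x := fun x =>
      mul_nonneg (by positivity) (le_min (hg0 x) (Nat.cast_nonneg n))
    have hvm : AEMeasurable (fun x => Real.sinh (t x)) P :=
      Real.measurable_sinh.comp_aemeasurable htm
    have hv0 : ∀ x, 0 ≤ Real.sinh (t x) := fun x => Real.sinh_nonneg_iff.2 (ht0 x)
    have hfin : ∫⁻ x, ENNReal.ofReal (cosh2Conj (Real.sinh (t x))) ∂P ≠ ∞ := by
      refine ne_top_of_le_ne_top
        (b := ∫⁻ _, ENNReal.ofReal (cosh2Conj (Real.sinh (K⁻¹ * n))) ∂P) (by simp)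
        (lintegral_mono fun x => ENNReal.ofReal_le_ofReal (cosh2Conj_le_of_abs_le ?_))
      rw [abs_of_nonneg (hv0 x), abs_of_nonneg (Real.sinh_nonneg_iff.2 (by positivity)),
        Real.sinh_le_sinh]
      exact mul_le_mul_of_nonneg_left (min_le_right _ _) (by positivity)
    have h1 := scaled _ hvm hv0 _ ENNReal.toReal_nonneg (ENNReal.ofReal_toReal hfin).symm
    rw [ENNReal.ofReal_toReal hfin] at h1
    -- Equality in the Young inequality at `sinh t`, integrated.
    have h2 : ∫⁻ x, ENNReal.ofReal (cosh2 (t x)) ∂P +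
        ∫⁻ x, ENNReal.ofReal (cosh2Conj (Real.sinh (t x))) ∂P ≤
          ∫⁻ x, ENNReal.ofReal (K⁻¹ * (Real.sinh (t x) * g x)) ∂P := by
      rw [← lintegral_add_left' (aemeasurable_ofReal_comp continuous_cosh2 htm)]
      refine lintegral_mono fun x => ?_
      rw [← ENNReal.ofReal_add (cosh2_nonneg _) (cosh2Conj_nonneg _), cosh2Conj_sinh]
      refine ENNReal.ofReal_le_ofReal ?_
      have h3 : t x ≤ K⁻¹ * g x := mul_le_mul_of_nonneg_left (min_le_left _ _) (by positivity)
      have h4 := mul_le_mul_of_nonneg_right h3 (hv0 x)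
      linarith
    exact (ENNReal.add_le_add_iff_right hfin).1 (h2.trans h1)
  have hlim : ∫⁻ x, ENNReal.ofReal (cosh2 (K⁻¹ * g x)) ∂P ≤ 1 := by
    refine le_of_tendsto' (lintegral_tendsto_of_tendsto_of_monotone (μ := P)
      (f := fun (n : ℕ) x => ENNReal.ofReal (cosh2 (K⁻¹ * min (g x) n)))
      (fun n => aemeasurable_ofReal_comp continuous_cosh2
        ((hgm.min aemeasurable_const).const_mul _))
      (ae_of_all _ fun x m n hmn => ENNReal.ofReal_le_ofReal (cosh2_le_of_abs_le ?_))
      (ae_of_all _ fun x => ?_)) trunc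
    · have hm0 : 0 ≤ min (g x) m := le_min (hg0 x) (Nat.cast_nonneg m)
      have hmn' : min (g x) m ≤ min (g x) n := min_le_min_left _ (Nat.cast_le.2 hmn)
      rw [abs_of_nonneg (by positivity),
        abs_of_nonneg (mul_nonneg (by positivity) (hm0.trans hmn'))]
      exact mul_le_mul_of_nonneg_left hmn' (by positivity)
    · obtain ⟨N, hN⟩ := exists_nat_ge (g x)
      refine tendsto_const_nhds.congr' ?_
      filter_upwards [Filter.eventually_ge_atTop N] with n hn
      rw [min_eq_left (hN.trans (Nat.cast_le.2 hn))]
  refine ⟨K⁻¹, by positivity, lt_of_le_of_lt (lintegral_mono fun x => ?_)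
    ((lintegral_exp_abs_le P fun x => K⁻¹ * g x).trans_lt ?_)⟩
  · refine ENNReal.ofReal_le_ofReal (Real.exp_le_exp.2 (le_trans ?_ (le_abs_self _)))
    exact mul_le_mul_of_nonneg_left (le_max_left _ _) (by positivity)
  · exact ENNReal.add_lt_top.2
      ⟨ENNReal.mul_lt_top (by simp) (hlim.trans_lt ENNReal.one_lt_top), by simp⟩

/-! ### The conditions for an exponential change of measure -/

lemma IsTilt.sameOrlicz_iff {P Q : Measure Ω} [IsProbabilityMeasure P] [IsProbabilityMeasure Q]
    {f : Ω → ℝ} (h : IsTilt P Q f) :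
    SameOrlicz cosh2 P Q ↔ HasExpMoment P (fun x => -f x) ∧ HasExpMoment Q f := by
  constructor
  · rintro ⟨h1, -⟩
    exact ⟨h.symm.hasExpMoment_of_memOrlicz_imp fun v => (h1 v).2,
      h.hasExpMoment_of_memOrlicz_imp fun v => (h1 v).1⟩
  · rintro ⟨h1, h2⟩
    obtain ⟨C, hC, hPQ⟩ := (h.modularBounded_cosh2 h2).exists_luxNorm_le starShaped_cosh2
      aemeasurable_const h.ac
    obtain ⟨D, hD, hQP⟩ := (h.symm.modularBounded_cosh2 h1).exists_luxNorm_le starShaped_cosh2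
      aemeasurable_const h.ac'
    simp only [one_mul] at hPQ hQP
    refine ⟨fun v => ⟨fun hv => (hPQ v hv).1, fun hv => (hQP v hv).1⟩, D⁻¹, C, inv_pos.2 hD, hC,
      fun v hv => ⟨?_, (hPQ v hv).2⟩⟩
    rw [inv_mul_le_iff₀ hD]
    exact (hQP v (hPQ v hv).1).2

lemma IsTilt.mulIsoOrlicz_iff {P Q : Measure Ω} [IsProbabilityMeasure P]
    [IsProbabilityMeasure Q] {f m : Ω → ℝ} (h : IsTilt P Q f)
    (hm : m =ᵐ[Q] fun x => Real.exp (-f x)) :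
    MulIsoOrlicz cosh2Conj P Q m ↔ HasExpMoment P (fun x => -f x) ∧ HasExpMoment Q f := by
  have hmv : ∀ v : Ω → ℝ, (fun x => m x * v x) =ᵐ[Q] fun x => Real.exp (-f x) * v x := fun v => by
    filter_upwards [hm] with x hx
    rw [hx]
  have hinv : ∀ (a : ℝ) (b : ℝ), Real.exp (-a) * (Real.exp a * b) = b := fun a b => by
    rw [← mul_assoc, ← Real.exp_add]; simp
  constructor
  · rintro ⟨h1, h2, c, C, hc, hC, h3⟩
    refine ⟨h.hasExpMoment_of_luxNorm_le hC fun v hv =>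
      ⟨(h1 v hv).congr (hmv v), luxNorm_congr (hmv v) ▸ (h3 v hv).2⟩, ?_⟩
    have h4 := h.symm.hasExpMoment_of_luxNorm_le (inv_pos.2 hc) fun w hw => ?_
    · simpa only [neg_neg] using h4
    -- The inverse operator is multiplication by `e^f`.
    obtain ⟨v, hv, hwv⟩ := h2 w hw
    have hvw : v =ᵐ[P] fun x => Real.exp (- -f x) * w x := by
      refine h.ac'.ae_le ?_
      filter_upwards [hwv, hm] with x hx hx'
      rw [hx, hx', neg_neg, ← mul_assoc, ← Real.exp_add]
      simp
    refine ⟨hv.congr hvw, ?_⟩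
    rw [← luxNorm_congr hvw, le_inv_mul_iff₀ hc, luxNorm_congr hwv]
    exact (h3 v hv).1
  · rintro ⟨h1, h2⟩
    have hexp : AEMeasurable (fun x => Real.exp (-f x)) Q :=
      Real.measurable_exp.comp_aemeasurable h.symm.aemeasurable
    have hexp' : AEMeasurable (fun x => Real.exp (- -f x)) P :=
      Real.measurable_exp.comp_aemeasurable h.aemeasurable.neg.neg
    obtain ⟨C, hC, hPQ⟩ := (h.modularBounded_cosh2Conj h1).exists_luxNorm_le
      starShaped_cosh2Conj hexp h.ac
    obtain ⟨D, hD, hQP⟩ := (h.symm.modularBounded_cosh2Conj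
      (by simpa only [neg_neg] using h2)).exists_luxNorm_le starShaped_cosh2Conj hexp' h.ac'
    simp only [neg_neg] at hQP
    refine ⟨fun v hv => (hPQ v hv).1.congr (hmv v).symm, fun w hw => ?_, D⁻¹, C, inv_pos.2 hD, hC,
      fun v hv => ?_⟩
    · refine ⟨_, (hQP w hw).1, ?_⟩
      filter_upwards [hm] with x hx
      rw [hx, hinv]
    · rw [luxNorm_congr (hmv v)]
      refine ⟨?_, (hPQ v hv).2⟩
      have h3 := (hQP _ (hPQ v hv).1).2
      have h4 : ∀ x, Real.exp (f x) * (Real.exp (-f x) * v x) = v x := fun x => by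
        have := hinv (-f x) (v x)
        rwa [neg_neg] at this
      simp only [h4] at h3
      rwa [inv_mul_le_iff₀ hD]

lemma IsTilt.memUnionLp_iff {P Q : Measure Ω} {f m : Ω → ℝ} (h : IsTilt P Q f)
    (hm : m =ᵐ[Q] fun x => Real.exp (-f x)) :
    MemUnionLp Q m ↔ HasExpMoment P fun x => -f x := by
  have hmeas : AEStronglyMeasurable m Q :=
    ((Real.measurable_exp.comp_aemeasurable h.symm.aemeasurable).congr hm.symm).aestronglyMeasurable
  have key : ∀ α : ℝ, 1 < α → (MemLp m (ENNReal.ofReal α) Q ↔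
      momentFn P (fun x => (α - 1) * -f x) < ∞) := by
    intro α hα
    have hα0 : 0 < α := zero_lt_one.trans hα
    have h1 : ∫⁻ x, ‖m x‖ₑ ^ (ENNReal.ofReal α).toReal ∂Q =
        momentFn P fun x => (α - 1) * -f x := by
      rw [show (fun x => (α - 1) * -f x) = fun x => (1 + -α) * f x by ext x; ring,
        ← h.momentFn_eq]
      refine lintegral_congr_ae ?_
      filter_upwards [hm] with x hx
      rw [hx, Real.enorm_of_nonneg (Real.exp_pos _).le, ENNReal.toReal_ofReal hα0.le,
        ENNReal.ofReal_rpow_of_pos (Real.exp_pos _), ← Real.exp_mul]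
      ring_nf
    rw [← h1, ← eLpNorm_lt_top_iff_lintegral_rpow_enorm_lt_top
      (ENNReal.ofReal_pos.2 hα0).ne' ENNReal.ofReal_ne_top]
    exact ⟨fun h => h.2, fun h => ⟨hmeas, h⟩⟩
  constructor
  · rintro ⟨α, hα, h1⟩
    exact ⟨α - 1, sub_pos.2 hα, (key α hα).1 h1⟩
  · rintro ⟨ε, hε, h1⟩
    exact ⟨1 + ε, by linarith, (key (1 + ε) (by linarith)).2 (by simpa using h1)⟩

/-! ### Moments and centred random variables -/

lemma momentFn_add_const (ν : Measure Ω) (u : Ω → ℝ) (c : ℝ) :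
    momentFn ν (fun x => u x + c) = ENNReal.ofReal (Real.exp c) * momentFn ν u := by
  rw [momentFn, momentFn, ← lintegral_const_mul' _ _ ENNReal.ofReal_ne_top]
  simp only [← ENNReal.ofReal_mul (Real.exp_pos _).le, ← Real.exp_add, add_comm]

lemma momentFn_congr {ν : Measure Ω} {u v : Ω → ℝ} (h : u =ᵐ[ν] v) :
    momentFn ν u = momentFn ν v :=
  lintegral_congr_ae (by filter_upwards [h] with x hx; rw [hx])

/-- Adding a constant to `u` does not affect the finiteness of its moments. -/
lemma momentFn_lt_top_of_eq_add_const {ν : Measure Ω} {u v : Ω → ℝ} {a c : ℝ}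
    (hv : v =ᵐ[ν] fun x => u x + c) (h : momentFn ν (fun x => a * u x) < ∞) :
    momentFn ν (fun x => a * v x) < ∞ := by
  have h1 : (fun x => a * v x) =ᵐ[ν] fun x => a * u x + a * c := by
    filter_upwards [hv] with x hx
    rw [hx, mul_add]
  rw [momentFn_congr h1, momentFn_add_const]
  exact ENNReal.mul_lt_top ENNReal.ofReal_lt_top h

lemma momentFn_lt_top_of_le_of_le {ν : Measure Ω} {u : Ω → ℝ} (hu : AEMeasurable u ν) {a b c : ℝ}
    (hab : a ≤ b) (hbc : b ≤ c) (ha : momentFn ν (fun x => a * u x) < ∞)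
    (hc : momentFn ν (fun x => c * u x) < ∞) : momentFn ν (fun x => b * u x) < ∞ := by
  have hm : AEMeasurable (fun x => ENNReal.ofReal (Real.exp (a * u x))) ν :=
    aemeasurable_ofReal_comp (Φ := fun t => Real.exp (a * t)) (by fun_prop) hu
  refine (lintegral_mono fun x => ?_).trans_lt
    ((lintegral_add_left' hm fun x => ENNReal.ofReal (Real.exp (c * u x))).trans_lt
      (ENNReal.add_lt_top.2 ⟨ha, hc⟩))
  rw [← ENNReal.ofReal_add (Real.exp_pos _).le (Real.exp_pos _).le]
  refine ENNReal.ofReal_le_ofReal ?_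
  rcases le_total 0 (u x) with h | h
  · have := Real.exp_le_exp.2 (mul_le_mul_of_nonneg_right hbc h)
    linarith [Real.exp_pos (a * u x)]
  · have := Real.exp_le_exp.2 (mul_le_mul_of_nonpos_right hab h)
    linarith [Real.exp_pos (c * u x)]

lemma momentFn_ne_zero {ν : Measure Ω} [NeZero ν] {u : Ω → ℝ} (hu : AEMeasurable u ν) :
    momentFn ν u ≠ 0 := by
  have hm : AEMeasurable (fun x => ENNReal.ofReal (Real.exp (u x))) ν :=
    aemeasurable_ofReal_comp Real.continuous_exp hu
  rw [momentFn, Ne, lintegral_eq_zero_iff' hm]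
  intro h
  obtain ⟨x, hx⟩ := h.exists
  simp only [Pi.zero_apply, ENNReal.ofReal_eq_zero] at hx
  exact (Real.exp_pos _).not_ge hx

lemma MemOrlicz.const_mul {Φ : ℝ → ℝ} {ν : Measure Ω} {v : Ω → ℝ} (hv : MemOrlicz Φ ν v) {a : ℝ}
    (ha : 0 < a) : MemOrlicz Φ ν fun x => a * v x := by
  obtain ⟨h0, ρ, hρ, h1⟩ := hv
  refine ⟨h0.const_mul a, a * ρ, by positivity, ?_⟩
  have h2 : ∀ x, (a * ρ)⁻¹ * (a * v x) = ρ⁻¹ * v x := fun x => by field_simp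
  simpa only [h2] using h1

lemma memOrlicz_cosh2_const (ν : Measure Ω) [IsFiniteMeasure ν] (c : ℝ) :
    MemOrlicz cosh2 ν fun _ => c := by
  refine ⟨aemeasurable_const, 1, one_pos, ?_⟩
  rw [lintegral_const]
  exact ENNReal.mul_lt_top ENNReal.ofReal_lt_top (measure_lt_top _ _)

lemma MemOrlicz.neg {ν : Measure Ω} [IsFiniteMeasure ν] {v : Ω → ℝ} (hv : MemOrlicz cosh2 ν v) :
    MemOrlicz cosh2 ν fun x => -v x := by
  simpa using (memOrlicz_cosh2_const ν 0).sub hv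

lemma MemOrlicz.integrable {ν : Measure Ω} [IsProbabilityMeasure ν] {v : Ω → ℝ}
    (hv : MemOrlicz cosh2 ν v) : Integrable v ν := by
  obtain ⟨h0, ρ, hρ, h1⟩ := hv
  have h2 : Integrable (fun x => ρ⁻¹ * v x) ν := by
    refine ⟨(h0.const_mul _).aestronglyMeasurable, ?_⟩
    refine lt_of_le_of_lt (lintegral_mono fun x => ?_)
      ((lintegral_exp_abs_le ν fun x => ρ⁻¹ * v x).trans_lt
        (ENNReal.add_lt_top.2 ⟨ENNReal.mul_lt_top (by simp) h1, by simp⟩))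
    rw [Real.enorm_eq_ofReal_abs]
    exact ENNReal.ofReal_le_ofReal (by linarith [Real.add_one_le_exp |ρ⁻¹ * v x|])
  simpa [← mul_assoc, hρ.ne'] using h2.const_mul ρ

lemma memOrlicz_cosh2_of_momentFn_lt_top {ν : Measure Ω} {u : Ω → ℝ}
    (hu : AEMeasurable u ν) {a : ℝ} (ha : 0 < a) (h1 : momentFn ν (fun x => a * u x) < ∞)
    (h2 : momentFn ν (fun x => -a * u x) < ∞) : MemOrlicz cosh2 ν u := by
  refine ⟨hu, a⁻¹, inv_pos.2 ha, ?_⟩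
  have hm : AEMeasurable (fun x => ENNReal.ofReal (Real.exp (a * u x))) ν :=
    aemeasurable_ofReal_comp (Φ := fun t => Real.exp (a * t)) (by fun_prop) hu
  refine (lintegral_mono fun x => ?_).trans_lt
    ((lintegral_add_left' hm fun x => ENNReal.ofReal (Real.exp (-a * u x))).trans_lt
      (ENNReal.add_lt_top.2 ⟨h1, h2⟩))
  rw [← ENNReal.ofReal_add (Real.exp_pos _).le (Real.exp_pos _).le, inv_inv]
  refine ENNReal.ofReal_le_ofReal ?_
  have e1 := Real.exp_pos (a * u x)
  have e2 := Real.exp_pos (-(a * u x))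
  rw [cosh2, Real.cosh_eq, neg_mul]
  linarith

lemma SameOrlicz.symm {Φ : ℝ → ℝ} {ν₁ ν₂ : Measure Ω} (h : SameOrlicz Φ ν₁ ν₂) :
    SameOrlicz Φ ν₂ ν₁ := by
  obtain ⟨h1, c, C, hc, hC, h2⟩ := h
  refine ⟨fun f => (h1 f).symm, C⁻¹, c⁻¹, inv_pos.2 hC, inv_pos.2 hc, fun f hf => ?_⟩
  rw [inv_mul_le_iff₀ hC, le_inv_mul_iff₀ hc]
  exact (h2 f ((h1 f).2 hf)).symm

/-- The interior of the proper domain depends on the space `L^{cosh2}(ν)` only through its elements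
and the equivalence class of its norm. -/
lemma MemInteriorDomain.of_sameOrlicz {ν₁ ν₂ π : Measure Ω} (h : SameOrlicz cosh2 ν₁ ν₂)
    {u : Ω → ℝ} (hu : MemInteriorDomain ν₁ π u) : MemInteriorDomain ν₂ π u := by
  obtain ⟨h1, c, C, hc, hC, h2⟩ := h
  obtain ⟨⟨hu1, hu2⟩, ε, hε, h3⟩ := hu
  refine ⟨⟨(h1 u).1 hu1, hu2⟩, c * ε, by positivity, fun v ⟨hv1, hv2⟩ hlt => ?_⟩
  have hv := (h1 v).2 hv1
  refine h3 v ⟨hv, hv2⟩ ?_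
  exact lt_of_mul_lt_mul_left ((h2 _ (hv.sub hu1)).1.trans_lt hlt) hc.le

lemma MemInteriorDomain.momentFn_lt_top {ν π : Measure Ω} {u : Ω → ℝ}
    (hu : MemInteriorDomain ν π u) : momentFn π u < ∞ := by
  obtain ⟨h1, ε, hε, h2⟩ := hu
  refine h2 u h1 ((luxNorm_le (half_pos hε) ?_).trans_lt (half_lt_self hε))
  simp [cosh2]

/-- A ray through an interior point stays in the proper domain for a while. -/
lemma MemInteriorDomain.exists_momentFn_lt_top {ν π : Measure Ω} {u : Ω → ℝ}
    (hu : MemInteriorDomain ν π u) :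
    ∃ t : ℝ, 0 < t ∧ momentFn π (fun x => (1 + t) * u x) < ∞ := by
  obtain ⟨⟨h1, h2, h3⟩, ε, hε, h4⟩ := hu
  obtain ⟨ρ, hρ, h5⟩ := h1.exists_le_one starShaped_cosh2
  have ht : 0 < ε / (2 * ρ) := by positivity
  refine ⟨ε / (2 * ρ), ht, h4 _ ⟨h1.const_mul (by positivity), h2.const_mul _, ?_⟩ ?_⟩
  · rw [integral_const_mul, h3, mul_zero]
  · refine (luxNorm_le (half_pos hε) ?_).trans_lt (half_lt_self hε)
    have h6 : ∀ x, (ε / 2)⁻¹ * ((1 + ε / (2 * ρ)) * u x - u x) = ρ⁻¹ * u x := fun x => by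
      field_simp
      ring
    simpa only [h6] using h5

/-- A centred `u` with a finite moment beyond `1` is interior: if `w` is small in norm, then
`e^{u + w}` is at most `e^{(1 + t) u} + e^{(1 + t) / t |w|}`. -/
lemma memInteriorDomain_of_momentFn_lt_top {P : Measure Ω} [IsProbabilityMeasure P] {u : Ω → ℝ}
    (hu : MemCentred P P u) {t : ℝ} (ht : 0 < t)
    (h : momentFn P (fun x => (1 + t) * u x) < ∞) : MemInteriorDomain P P u := by
  refine ⟨hu, t / (1 + t), by positivity, fun v hv hlt => ?_⟩
  have h1 := (hv.1.sub hu.1).lintegral_le_one starShaped_cosh2 hlt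
  have hm : AEMeasurable (fun x => ENNReal.ofReal (Real.exp ((1 + t) * u x))) P :=
    aemeasurable_ofReal_comp (Φ := fun y => Real.exp ((1 + t) * y)) (by fun_prop) hu.1.1
  refine (lintegral_mono fun x => ?_).trans_lt ((lintegral_add_left' hm fun x =>
    ENNReal.ofReal (Real.exp |(t / (1 + t))⁻¹ * (v x - u x)|)).trans_lt
      (ENNReal.add_lt_top.2 ⟨h, (lintegral_exp_abs_le P _).trans_lt ?_⟩))
  · rw [← ENNReal.ofReal_add (Real.exp_pos _).le (Real.exp_pos _).le]
    refine ENNReal.ofReal_le_ofReal (le_trans ?_ (exp_add_mul_le ht _ _))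
    refine Real.exp_le_exp.2 ?_
    have h2 : 0 < t / (1 + t) := by positivity
    rw [abs_mul, abs_of_pos (inv_pos.2 h2), mul_inv_cancel_left₀ h2.ne']
    linarith [le_abs_self (v x - u x)]
  · exact ENNReal.add_lt_top.2
      ⟨ENNReal.mul_lt_top (by simp) (h1.trans_lt ENNReal.one_lt_top), by simp⟩

/-! ### Densities -/

lemma IsPosDensity.isProbabilityMeasure {μ : Measure Ω} {p : Ω → ℝ} (hp : IsPosDensity μ p) :
    IsProbabilityMeasure (densMeasure μ p) :=
  ⟨by rw [densMeasure, withDensity_apply _ MeasurableSet.univ, Measure.restrict_univ, hp.2.2]⟩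

lemma densMeasure_ac (μ : Measure Ω) (p : Ω → ℝ) : densMeasure μ p ≪ μ :=
  withDensity_absolutelyContinuous _ _

lemma IsPosDensity.ac {μ : Measure Ω} {p : Ω → ℝ} (hp : IsPosDensity μ p) :
    μ ≪ densMeasure μ p := by
  refine withDensity_absolutelyContinuous' hp.1.ennreal_ofReal ?_
  filter_upwards [hp.2.1] with x hx
  simpa using hx

lemma IsPosDensity.lintegral_eq {μ : Measure Ω} {p : Ω → ℝ} (hp : IsPosDensity μ p)
    (u : Ω → ℝ) :
    ∫⁻ x, ENNReal.ofReal (Real.exp (u x) * p x) ∂μ = momentFn (densMeasure μ p) u := by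
  rw [momentFn, densMeasure, lintegral_withDensity_eq_lintegral_mul_non_measurable₀ _
    hp.1.ennreal_ofReal (ae_of_all _ fun _ => ENNReal.ofReal_lt_top)]
  refine lintegral_congr fun x => ?_
  rw [ENNReal.ofReal_mul (Real.exp_pos _).le, mul_comm]
  rfl

/-- The logarithm of the likelihood ratio of two densities. -/
noncomputable def logRatio (p q : Ω → ℝ) (x : Ω) : ℝ := Real.log (q x / p x)

lemma exp_logRatio_mul {μ : Measure Ω} {p q : Ω → ℝ} (hp : IsPosDensity μ p)
    (hq : IsPosDensity μ q) : (fun x => Real.exp (logRatio p q x) * p x) =ᵐ[μ] q := by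
  filter_upwards [hp.2.1, hq.2.1] with x h1 h2
  rw [logRatio, Real.exp_log (div_pos h2 h1), div_mul_cancel₀ _ h1.ne']

lemma momentFn_logRatio {μ : Measure Ω} {p q : Ω → ℝ} (hp : IsPosDensity μ p)
    (hq : IsPosDensity μ q) : momentFn (densMeasure μ p) (logRatio p q) = 1 := by
  rw [← hp.lintegral_eq, ← hq.2.2]
  refine lintegral_congr_ae ?_
  filter_upwards [exp_logRatio_mul hp hq] with x hx
  rw [hx]

lemma IsPosDensity.isTilt {μ : Measure Ω} {p q : Ω → ℝ} (hp : IsPosDensity μ p)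
    (hq : IsPosDensity μ q) : IsTilt (densMeasure μ p) (densMeasure μ q) (logRatio p q) := by
  have hm : AEMeasurable (logRatio p q) μ := Real.measurable_log.comp_aemeasurable (hq.1.div hp.1)
  refine ⟨hm.mono_ac (densMeasure_ac μ p), ?_⟩
  rw [densMeasure, densMeasure, ← withDensity_mul₀ hp.1.ennreal_ofReal
    (aemeasurable_ofReal_comp Real.continuous_exp hm)]
  refine withDensity_congr_ae ?_
  filter_upwards [exp_logRatio_mul hp hq] with x hx
  rw [← hx, ENNReal.ofReal_mul (Real.exp_pos _).le, mul_comm]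
  rfl

lemma div_ae_eq_exp_neg_logRatio {μ : Measure Ω} {p q : Ω → ℝ} (hp : IsPosDensity μ p)
    (hq : IsPosDensity μ q) :
    (fun x => p x / q x) =ᵐ[μ] fun x => Real.exp (-logRatio p q x) := by
  filter_upwards [hp.2.1, hq.2.1] with x h1 h2
  rw [logRatio, Real.exp_neg, Real.exp_log (div_pos h2 h1), inv_div]

lemma memUnionLp_and_iff {μ : Measure Ω} {p q : Ω → ℝ} (hp : IsPosDensity μ p)
    (hq : IsPosDensity μ q) :
    MemUnionLp (densMeasure μ q) (fun x => p x / q x) ∧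
        MemUnionLp (densMeasure μ p) (fun x => q x / p x) ↔
      HasExpMoment (densMeasure μ p) (fun x => -logRatio p q x) ∧
        HasExpMoment (densMeasure μ q) (logRatio p q) := by
  have h := hp.isTilt hq
  have h1 : (fun x => q x / p x) =ᵐ[densMeasure μ p] fun x => Real.exp (- -logRatio p q x) := by
    refine (densMeasure_ac μ p).ae_le ?_
    filter_upwards [hp.2.1, hq.2.1] with x h1 h2
    rw [logRatio, neg_neg, Real.exp_log (div_pos h2 h1)]
  rw [h.memUnionLp_iff ((densMeasure_ac μ q).ae_le (div_ae_eq_exp_neg_logRatio hp hq)),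
    h.symm.memUnionLp_iff h1]
  simp only [neg_neg]

/-- If `q` is proportional to `e^u · p`, then `u` is the logarithm of the likelihood ratio up to a
constant. -/
lemma logRatio_ae_eq {μ : Measure Ω} {p q u : Ω → ℝ} (hp : IsPosDensity μ p) {c : ℝ}
    (h : q =ᵐ[μ] fun x => Real.exp (u x + c) * p x) :
    logRatio p q =ᵐ[densMeasure μ p] fun x => u x + c := by
  refine (densMeasure_ac μ p).ae_le ?_
  filter_upwards [h, hp.2.1] with x hx hx'
  rw [logRatio, hx, mul_div_cancel_right₀ _ hx'.ne', Real.log_exp]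

lemma openExpArc_iff {μ : Measure Ω} {p q : Ω → ℝ} (hp : IsPosDensity μ p)
    (hq : IsPosDensity μ q) :
    OpenExpArc μ p q ↔ HasExpMoment (densMeasure μ p) (fun x => -logRatio p q x) ∧
      HasExpMoment (densMeasure μ q) (logRatio p q) := by
  have := hp.isProbabilityMeasure
  have := hq.isProbabilityMeasure
  have ht := hp.isTilt hq
  constructor
  · rintro ⟨I, U, r, hI, -, h01, -, hr, -, hr1⟩
    have hfin : ∀ θ ∈ I, momentFn (densMeasure μ p) (fun x => θ * U x) < ∞ := by
      intro θ hθ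
      obtain ⟨⟨-, -, h1⟩, c, hc, h2⟩ := hr θ hθ
      rw [lintegral_congr_ae (g := fun x => ENNReal.ofReal c *
        ENNReal.ofReal (Real.exp (θ * U x) * p x)) (by
          filter_upwards [h2] with x hx; rw [hx, ENNReal.ofReal_mul hc.le]),
        lintegral_const_mul' _ _ ENNReal.ofReal_ne_top, hp.lintegral_eq] at h1
      refine lt_top_iff_ne_top.2 fun h3 => ?_
      rw [h3, ENNReal.mul_top (ENNReal.ofReal_pos.2 hc).ne'] at h1
      exact ENNReal.top_ne_one h1
    obtain ⟨-, c, hc, h2⟩ := hr 1 (h01 (by simp))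
    have hf : logRatio p q =ᵐ[densMeasure μ p] fun x => U x + Real.log c := by
      refine logRatio_ae_eq hp ?_
      filter_upwards [hr1, h2] with x hx hx'
      rw [← hx, hx', one_mul, Real.exp_add, Real.exp_log hc]
      ring
    constructor
    · obtain ⟨δ, hδ, h3⟩ := Metric.isOpen_iff.1 hI 0 (h01 (by simp))
      have h4 : -(δ / 2) ∈ I := h3 (by
        rw [Metric.mem_ball, dist_zero_right, norm_neg, Real.norm_of_nonneg (by positivity)]
        linarith)
      refine ⟨δ / 2, half_pos hδ, ?_⟩
      simpa using momentFn_lt_top_of_eq_add_const hf (hfin _ h4)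
    · obtain ⟨δ, hδ, h3⟩ := Metric.isOpen_iff.1 hI 1 (h01 (by simp))
      have h4 : 1 + δ / 2 ∈ I := h3 (by
        rw [Metric.mem_ball, Real.dist_eq, add_sub_cancel_left, abs_of_pos (half_pos hδ)]
        linarith)
      refine ⟨δ / 2, half_pos hδ, ?_⟩
      rw [ht.momentFn_eq]
      exact momentFn_lt_top_of_eq_add_const hf (hfin _ h4)
  · rintro ⟨⟨a, ha, h1⟩, b, hb, h2⟩
    rw [ht.momentFn_eq] at h2
    set M : ℝ → ℝ≥0∞ := fun θ => momentFn (densMeasure μ p) fun x => θ * logRatio p q x with hM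
    have hM0 : M 0 = 1 := by simp [hM, momentFn]
    have hM1 : M 1 = 1 := by simpa [hM] using momentFn_logRatio hp hq
    have hm : AEMeasurable (logRatio p q) μ := ht.aemeasurable.mono_ac hp.ac
    refine ⟨Ioo (-a) (1 + b), logRatio p q,
      fun θ x => (M θ).toReal⁻¹ * (Real.exp (θ * logRatio p q x) * p x), isOpen_Ioo,
      ordConnected_Ioo, fun θ hθ => ⟨by linarith [hθ.1], by linarith [hθ.2]⟩, hm,
      fun θ hθ => ?_, ?_, ?_⟩
    · have hne : M θ ≠ ∞ := (momentFn_lt_top_of_le_of_le ht.aemeasurable hθ.1.le hθ.2.le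
        (by simpa using h1) h2).ne
      have hpos : 0 < (M θ).toReal :=
        ENNReal.toReal_pos (momentFn_ne_zero (ht.aemeasurable.const_mul θ)) hne
      refine ⟨⟨((Real.measurable_exp.comp_aemeasurable (hm.const_mul θ)).mul hp.1).const_mul _,
        ?_, ?_⟩, _, inv_pos.2 hpos, ae_eq_refl _⟩
      · filter_upwards [hp.2.1] with x hx
        positivity
      · simp only [ENNReal.ofReal_mul (inv_pos.2 hpos).le]
        rw [lintegral_const_mul' _ _ ENNReal.ofReal_ne_top, hp.lintegral_eq,
          ENNReal.ofReal_inv_of_pos hpos, ENNReal.ofReal_toReal hne]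
        exact ENNReal.inv_mul_cancel (momentFn_ne_zero (ht.aemeasurable.const_mul θ)) hne
    · exact ae_of_all _ fun x => by simp [hM0]
    · filter_upwards [exp_logRatio_mul hp hq] with x hx
      simpa [hM1] using hx

lemma isExpDensity_iff {μ : Measure Ω} {p q : Ω → ℝ} (hp : IsPosDensity μ p)
    (hq : IsPosDensity μ q) :
    IsExpDensity (densMeasure μ p) μ p q ↔
      HasExpMoment (densMeasure μ p) (fun x => -logRatio p q x) ∧
        HasExpMoment (densMeasure μ q) (logRatio p q) := by
  have := hp.isProbabilityMeasure
  have := hq.isProbabilityMeasure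
  have ht := hp.isTilt hq
  constructor
  · rintro ⟨u, hu, hqu⟩
    have hf := logRatio_ae_eq (u := u) hp hqu
    constructor
    · obtain ⟨ε, hε, h1⟩ := hu.1.1.neg.hasExpMoment
      refine ⟨ε, hε, ?_⟩
      simp only [mul_neg, ← neg_mul] at h1 ⊢
      exact momentFn_lt_top_of_eq_add_const hf h1
    · obtain ⟨t, ht0, h1⟩ := hu.exists_momentFn_lt_top
      refine ⟨t, ht0, ?_⟩
      rw [ht.momentFn_eq]
      exact momentFn_lt_top_of_eq_add_const hf h1
  · rintro ⟨⟨a, ha, h1⟩, b, hb, h2⟩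
    rw [ht.momentFn_eq] at h2
    simp only [mul_neg, ← neg_mul] at h1
    have hmem : MemOrlicz cosh2 (densMeasure μ p) (logRatio p q) := by
      have hd : 0 < min a (1 + b) := by positivity
      have hd1 := min_le_left a (1 + b)
      have hd2 := min_le_right a (1 + b)
      exact memOrlicz_cosh2_of_momentFn_lt_top ht.aemeasurable hd
        (momentFn_lt_top_of_le_of_le ht.aemeasurable (by linarith) hd2 h1 h2)
        (momentFn_lt_top_of_le_of_le ht.aemeasurable (by linarith) (by linarith) h1 h2)
    set e := ∫ x, logRatio p q x ∂(densMeasure μ p) with he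
    have hint := hmem.integrable
    have hcent : MemCentred (densMeasure μ p) (densMeasure μ p) fun x => logRatio p q x - e := by
      refine ⟨hmem.sub (memOrlicz_cosh2_const _ e), hint.sub (integrable_const e), ?_⟩
      rw [integral_sub hint (integrable_const e)]
      simp [he]
    have hK : cumulantFn (densMeasure μ p) (fun x => logRatio p q x - e) = -e := by
      simp only [sub_eq_add_neg]
      rw [cumulantFn, momentFn_add_const, momentFn_logRatio hp hq, mul_one,
        ENNReal.toReal_ofReal (Real.exp_pos _).le, Real.log_exp]
    refine ⟨fun x => logRatio p q x - e, memInteriorDomain_of_momentFn_lt_top hcent hb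
      (momentFn_lt_top_of_eq_add_const (c := -e) (ae_of_all _ fun x => ?_) h2), ?_⟩
    · rfl
    · filter_upwards [exp_logRatio_mul hp hq] with x hx
      rw [hK, sub_neg_eq_add, sub_add_cancel, hx]

/-- The equivalences for two positive densities: each of the conditions says that the logarithm of
`q / p` has a finite moment to the left of `0` and one to the right of `1`. -/
lemma tfae_of_isPosDensity {μ : Measure Ω} {p q : Ω → ℝ} (hp : IsPosDensity μ p)
    (hq : IsPosDensity μ q) :
    List.TFAE [
      IsExpDensity (densMeasure μ p) μ p q,
      OpenExpArc μ p q,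
      SameOrlicz cosh2 (densMeasure μ p) (densMeasure μ q),
      MemUnionLp (densMeasure μ q) (fun x => p x / q x) ∧
        MemUnionLp (densMeasure μ p) (fun x => q x / p x),
      MulIsoOrlicz cosh2Conj (densMeasure μ p) (densMeasure μ q) (fun x => p x / q x)] := by
  have := hp.isProbabilityMeasure
  have := hq.isProbabilityMeasure
  have ht := hp.isTilt hq
  have h1 := isExpDensity_iff hp hq
  have h2 := openExpArc_iff hp hq
  have h3 := ht.sameOrlicz_iff
  have h4 := memUnionLp_and_iff hp hq
  have h5 := ht.mulIsoOrlicz_iff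
    ((densMeasure_ac μ q).ae_le (div_ae_eq_exp_neg_logRatio hp hq))
  tfae_have 1 ↔ 2 := h1.trans h2.symm
  tfae_have 2 ↔ 3 := h2.trans h3.symm
  tfae_have 3 ↔ 4 := h3.trans h4.symm
  tfae_have 4 ↔ 5 := h4.trans h5.symm
  tfae_finish

/-! ### The maximal exponential model -/

lemma densMeasure_one (μ : Measure Ω) : densMeasure μ (fun _ => 1) = μ := by
  simp [densMeasure]

lemma isPosDensity_one (μ : Measure Ω) [IsProbabilityMeasure μ] : IsPosDensity μ fun _ => 1 :=
  ⟨aemeasurable_const, ae_of_all _ fun _ => one_pos, by simp⟩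

lemma MemMaxExp.isPosDensity {μ : Measure Ω} [IsProbabilityMeasure μ] {p : Ω → ℝ}
    (hp : MemMaxExp μ p) : IsPosDensity μ p := by
  obtain ⟨u, hu, hpu⟩ := hp
  have hum := hu.1.1.1
  have hne := hu.momentFn_lt_top.ne
  refine ⟨(Real.measurable_exp.comp_aemeasurable (hum.sub_const _)).congr hpu.symm, ?_, ?_⟩
  · filter_upwards [hpu] with x hx
    rw [hx]
    exact Real.exp_pos _
  · have hpos := ENNReal.toReal_pos (momentFn_ne_zero hum) hne
    calc ∫⁻ x, ENNReal.ofReal (p x) ∂μ = momentFn μ fun x => u x + -cumulantFn μ u :=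
          lintegral_congr_ae (by filter_upwards [hpu] with x hx; rw [hx, sub_eq_add_neg])
      _ = 1 := by
          rw [momentFn_add_const, Real.exp_neg, cumulantFn, Real.exp_log hpos,
            ENNReal.ofReal_inv_of_pos hpos, ENNReal.ofReal_toReal hne]
          exact ENNReal.inv_mul_cancel (momentFn_ne_zero hum) hne

/-- For `p` in the maximal exponential model, `L^{cosh2}(p) = L^{cosh2}(μ)` with equivalent norms:
these are the equivalences for the densities `1` and `p`. -/
lemma MemMaxExp.sameOrlicz {μ : Measure Ω} [IsProbabilityMeasure μ] {p : Ω → ℝ}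
    (hp : MemMaxExp μ p) : SameOrlicz cosh2 μ (densMeasure μ p) := by
  have h := (tfae_of_isPosDensity (isPosDensity_one μ) hp.isPosDensity).out 0 2
  rw [densMeasure_one] at h
  refine h.1 ?_
  obtain ⟨u, hu, hpu⟩ := hp
  refine ⟨u, ?_, ?_⟩ <;> rw [densMeasure_one]
  · exact hu
  · simpa using hpu

lemma IsExpDensity.of_sameOrlicz {ν₁ ν₂ μ : Measure Ω} (h : SameOrlicz cosh2 ν₁ ν₂)
    {p q : Ω → ℝ} (hpq : IsExpDensity ν₁ μ p q) : IsExpDensity ν₂ μ p q := by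
  obtain ⟨u, hu, hq⟩ := hpq
  exact ⟨u, hu.of_sameOrlicz h, hq⟩

end MaxExp

theorem mainTheorem1 {Ω : Type*} [MeasurableSpace Ω] (μ : Measure Ω) [IsProbabilityMeasure μ] :
    (∀ p q : Ω → ℝ, MaxExp.MemMaxExp μ p → MaxExp.MemMaxExp μ q →
      List.TFAE [
        MaxExp.IsExpDensity μ μ p q,
        MaxExp.OpenExpArc μ p q,
        MaxExp.SameOrlicz MaxExp.cosh2 (MaxExp.densMeasure μ p) (MaxExp.densMeasure μ q),
        MaxExp.MemUnionLp (MaxExp.densMeasure μ q) (fun x => p x / q x) ∧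
          MaxExp.MemUnionLp (MaxExp.densMeasure μ p) (fun x => q x / p x),
        MaxExp.MulIsoOrlicz MaxExp.cosh2Conj (MaxExp.densMeasure μ p) (MaxExp.densMeasure μ q)
          (fun x => p x / q x)]) ∧
    (∀ p q : Ω → ℝ, MaxExp.IsPosDensity μ p → MaxExp.IsPosDensity μ q →
      List.TFAE [
        MaxExp.IsExpDensity (MaxExp.densMeasure μ p) μ p q,
        MaxExp.OpenExpArc μ p q,
        MaxExp.SameOrlicz MaxExp.cosh2 (MaxExp.densMeasure μ p) (MaxExp.densMeasure μ q),
        MaxExp.MemUnionLp (MaxExp.densMeasure μ q) (fun x => p x / q x) ∧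
          MaxExp.MemUnionLp (MaxExp.densMeasure μ p) (fun x => q x / p x),
        MaxExp.MulIsoOrlicz MaxExp.cosh2Conj (MaxExp.densMeasure μ p) (MaxExp.densMeasure μ q)
          (fun x => p x / q x)]) := by
  refine ⟨fun p q hp hq => ?_, fun p q hp hq => MaxExp.tfae_of_isPosDensity hp hq⟩
  have h : MaxExp.IsExpDensity μ μ p q ↔ MaxExp.IsExpDensity (MaxExp.densMeasure μ p) μ p q :=
    ⟨fun h => h.of_sameOrlicz hp.sameOrlicz, fun h => h.of_sameOrlicz hp.sameOrlicz.symm⟩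
  rw [h]
  exact MaxExp.tfae_of_isPosDensity hp.isPosDensity hq.isPosDensity
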